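/- Let $(E,\mathcal A,\mu)$ be a probability space, let $T:E\to E$ be an invertible bimeasurable transformation preserving $\mu$, and let $f:E\to[0,1]$ be measurable with $\int_E f\,d\mu=\tfrac12$. For $x\in E$ let the quenched law $\mathbb P_T^{(x)}$ be the product probability measure on $\{-1,+1\}^{\mathbb Z}$ (with its product $\sigma$-algebra) with marginals $\mathbb P_T^{(x)}(\epsilon_y=+1)=f(T^yx)$, $y\in\mathbb Z$, and let the annealed law be $\mathbb P_\mu(A)=\int_E\mathbb P_T^{(x)}(A)\,d\mu(x)$. For $\epsilon\in\{-1,+1\}^{\mathbb Z}$ let $\mathbb L^\epsilon$ be the directed graph with vertex set $\mathbb Z^2$ in which $(u,v)$ is an edge if and only if either $v_1=u_1$ and $v_2=u_2\pm1$, or $v_2=u_2$ and $v_1=u_1+\epsilon_{u_2}$. The simple random walk on $\mathbb L^\epsilon$ is the $\mathbb Z^2$-valued Markov chain $(M_n)_{n\in\mathbb N}$ with transition probability $\tfrac13$ from $u$ to $v$ if $(u,v)$ is an edge and $0$ otherwise; it is called transient if for every vertex $u$ the walk started at $u$ almost surely visits $u$ only finitely many times. Assume that $$\int_E\frac{1}{\sqrt{f(1-f)}}\,d\mu<\infty$$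 (where $1/0=\infty$). Then: 1. (Annealed case) for $\mathbb P_\mu$-almost every orientation $\epsilon$, the simple random walk on $\mathbb L^\epsilon$ is transient; 2. (Quenched case) for $\mu$-almost every $x\in E$, for $\mathbb P_T^{(x)}$-almost every orientation $\epsilon$, the simple random walk on $\mathbb L^\epsilon$ is transient. -/

import Mathlib

open MeasureTheory ProbabilityTheory
open scoped ENNReal unitInterval

noncomputable section

namespace OrientedLattice

/-- Orientations of the horizontal lines of `ℤ²`: families `(ε_y)_{y ∈ ℤ}` with values in
`{1, -1}` (the units of `ℤ`), with the product σ-algebra. -/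
abbrev Orientation : Type := ℤ → ℤˣ

/-! ### The oriented lattice and its simple random walk -/

/-- The directed graph `L^ε` on `ℤ²`: vertical edges in both directions, and at height `y`
horizontal edges in the direction `ε_y` only. -/
def lattice (ε : Orientation) : Digraph (ℤ × ℤ) where
  Adj u v := (v.1 = u.1 ∧ (v.2 = u.2 + 1 ∨ v.2 = u.2 - 1)) ∨
    (v.2 = u.2 ∧ v.1 = u.1 + (ε u.2 : ℤ))

open Classical in
/-- Transition probabilities of the simple random walk: `1/3` along each edge, `0` otherwise. -/
def transProb (ε : Orientation) (u v : ℤ × ℤ) : ℝ≥0∞ :=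
  if (lattice ε).Adj u v then 1 / 3 else 0

/-- The three out-neighbours of a vertex. -/
def outNeighbors (ε : Orientation) (u : ℤ × ℤ) : Finset (ℤ × ℤ) :=
  {(u.1, u.2 + 1), (u.1, u.2 - 1), (u.1 + (ε u.2 : ℤ), u.2)}

theorem mem_outNeighbors (ε : Orientation) (u v : ℤ × ℤ) :
    v ∈ outNeighbors ε u ↔ (lattice ε).Adj u v := by
  simp only [outNeighbors, lattice, Finset.mem_insert, Finset.mem_singleton, Prod.ext_iff]
  tauto

theorem card_outNeighbors (ε : Orientation) (u : ℤ × ℤ) : (outNeighbors ε u).card = 3 := by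
  unfold outNeighbors
  have h0 : ((ε u.2 : ℤˣ) : ℤ) ≠ 0 := Units.ne_zero _
  rw [Finset.card_insert_of_notMem, Finset.card_insert_of_notMem, Finset.card_singleton]
  · simp only [Finset.mem_singleton, Prod.ext_iff]
    omega
  · simp only [Finset.mem_insert, Finset.mem_singleton, Prod.ext_iff]
    omega

/-- The law of one step of the simple random walk on `L^ε` from the vertex `u`. -/
def stepPMF (ε : Orientation) (u : ℤ × ℤ) : PMF (ℤ × ℤ) :=
  PMF.ofFinset (transProb ε u) (outNeighbors ε u)
    (by
      rw [Finset.sum_congr rfl (g := fun _ => (1 / 3 : ℝ≥0∞)), Finset.sum_const,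
        card_outNeighbors, nsmul_eq_mul]
      · exact ENNReal.mul_div_cancel (by norm_num) (by norm_num)
      · intro v hv
        rw [mem_outNeighbors] at hv
        simp [transProb, hv])
    (by
      intro v hv
      rw [mem_outNeighbors] at hv
      simp [transProb, hv])

/-- The transition kernel of the simple random walk on `L^ε`. -/
def stepKernel (ε : Orientation) : Kernel (ℤ × ℤ) (ℤ × ℤ) where
  toFun u := (stepPMF ε u).toMeasure
  measurable' := measurable_of_countable _

instance (ε : Orientation) : IsMarkovKernel (stepKernel ε) :=
  ⟨fun u => by change IsProbabilityMeasure (stepPMF ε u).toMeasure; infer_instance⟩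

/-- The law, on the space of trajectories, of the simple random walk `(M_n)_{n ∈ ℕ}` on `L^ε`
with `M_0 = u`: given `M_0, …, M_n`, the law of `M_{n+1}` is `stepKernel ε (M_n)`. -/
def walkLaw (ε : Orientation) (u : ℤ × ℤ) : Measure (ℕ → ℤ × ℤ) :=
  Kernel.trajMeasure (X := fun _ => ℤ × ℤ) (Measure.dirac u)
    (fun n => (stepKernel ε).comap
      (fun h : (i : Finset.Iic n) → ℤ × ℤ => h ⟨n, Finset.mem_Iic.2 le_rfl⟩)
      (measurable_pi_apply _))

/-- The simple random walk on `L^ε` is transient: every vertex is a transient state, that is,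
the walk started there almost surely visits it only finitely many times. -/
def IsTransient (ε : Orientation) : Prop :=
  ∀ u : ℤ × ℤ, ∀ᵐ M ∂(walkLaw ε u), {n : ℕ | M n = u}.Finite

/-! ### Random orientations generated by a dynamical system -/

/-- The law on `{1, -1}` that gives mass `p` to `1` and `1 - p` to `-1`. -/
def signLaw (p : I) : Measure ℤˣ :=
  ENNReal.ofReal (p : ℝ) • Measure.dirac 1 + ENNReal.ofReal (1 - (p : ℝ)) • Measure.dirac (-1)

instance (p : I) : IsProbabilityMeasure (signLaw p) := by
  constructor
  simp only [signLaw, Measure.coe_add, Measure.coe_smul, Pi.add_apply, Pi.smul_apply,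
    measure_univ, smul_eq_mul, mul_one]
  rw [← ENNReal.ofReal_add p.2.1 (by linarith [p.2.2])]
  simp

variable {E : Type*} [MeasurableSpace E]

theorem measurable_zpow (T : E ≃ᵐ E) (y : ℤ) :
    Measurable fun x => ((T.toEquiv : Equiv.Perm E) ^ y) x := by
  cases y with
  | ofNat n =>
    have : (fun x => ((T.toEquiv : Equiv.Perm E) ^ (Int.ofNat n)) x) = T^[n] := by
      rw [Int.ofNat_eq_natCast, zpow_natCast, Equiv.Perm.coe_pow]; rfl
    rw [this]
    exact T.measurable.iterate n
  | negSucc n =>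
    have : (fun x => ((T.toEquiv : Equiv.Perm E) ^ (Int.negSucc n)) x) = T.symm^[n + 1] := by
      rw [zpow_negSucc, ← inv_pow, Equiv.Perm.coe_pow]; rfl
    rw [this]
    exact T.symm.measurable.iterate _

/-- The quenched law `P_T^{(x)}`: the product over `y ∈ ℤ` of the laws on `{1, -1}` that give
mass `f (T^y x)` to `1`. -/
def quenchedLaw (T : E ≃ᵐ E) (f : E → I) (x : E) : Measure Orientation :=
  Measure.infinitePi fun y : ℤ => signLaw (f (((T.toEquiv : Equiv.Perm E) ^ y) x))

instance (T : E ≃ᵐ E) (f : E → I) (x : E) : IsProbabilityMeasure (quenchedLaw T f x) := by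
  unfold quenchedLaw; infer_instance

theorem measurable_quenchedLaw (T : E ≃ᵐ E) {f : E → I} (hf : Measurable f) :
    Measurable (quenchedLaw T f) := by
  refine Measurable.measure_of_isPiSystem_of_isProbabilityMeasure
    (generateFrom_squareCylinders (α := fun _ : ℤ => ℤˣ)).symm
    (isPiSystem_squareCylinders (fun _ => MeasurableSpace.isPiSystem_measurableSet)
      (fun _ => by simp)) ?_
  rintro _ ⟨s, t, ht, rfl⟩
  have ht' : ∀ i, MeasurableSet (t i) := fun i => ht i (Set.mem_univ i)
  have h : ∀ x, quenchedLaw T f x ((s : Set ℤ).pi t)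
      = ∏ y ∈ s, signLaw (f (((T.toEquiv : Equiv.Perm E) ^ y) x)) (t y) := fun x =>
    Measure.infinitePi_pi _ (fun i _ => ht' i)
  simp only [h]
  refine Finset.measurable_fun_prod _ fun y _ => ?_
  have hm : Measurable fun x => ((f (((T.toEquiv : Equiv.Perm E) ^ y) x) : I) : ℝ) :=
    measurable_subtype_coe.comp (hf.comp (measurable_zpow T y))
  simp only [signLaw, Measure.coe_add, Measure.coe_smul, Pi.add_apply, Pi.smul_apply, smul_eq_mul]
  exact (hm.ennreal_ofReal.mul_const _).add
    ((measurable_const.sub hm).ennreal_ofReal.mul_const _)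

/-- The annealed law `P_μ`, the average of the quenched laws `P_T^{(x)}` over `x` with law `μ`. -/
def annealedLaw (μ : Measure E) (T : E ≃ᵐ E) (f : E → I) : Measure Orientation :=
  μ.bind (quenchedLaw T f)

theorem annealedLaw_apply (μ : Measure E) (T : E ≃ᵐ E) {f : E → I} (hf : Measurable f)
    {A : Set Orientation} (hA : MeasurableSet A) :
    annealedLaw μ T f A = ∫⁻ x, quenchedLaw T f x A ∂μ :=
  Measure.bind_apply hA (measurable_quenchedLaw T hf).aemeasurable

end OrientedLattice

end

open MeasureTheory ProbabilityTheory
open scoped ENNReal unitInterval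

noncomputable section

namespace OrientedLattice

/-! ### Means over words -/

section WordMean

variable {α : Type*} [Fintype α] {V : Type*} [AddCommGroup V] [Module ℝ V]

/-! The annealed expected number of returns to each vertex is finite, because the annealed return
probability at time `N` is `O(N ^ (-5/4))`. Hence for almost every orientation all the Green sums
converge, and Borel-Cantelli gives transience. The annealed law being the average of the quenched
laws, an annealed null set is null for almost every quenched law.

A trajectory is coded by a uniform word of moves. It returns when its rise vanishes and the drift `∑
z, visits z * ε z` vanishes. Split the word as `2 * m + n` with `m ≤ n` both of order `N`, and cut
the first `2 * m` letters into pairs. The pairs `(0, 0)` and `(1, -1)` have the same rise and the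
same probability, so each may be resampled with a fair coin (`wordMean_two_mul`) without altering
the heights. In Fourier variables this yields a factor `cos θ ^ B`, where `B` is the number of
flippable pairs, and replaces the visits by their conditional means `M` (`wordMean_cexp_drift`). Let
`K z` be the number of flippable pairs at height `z`, so that `K ≤ M`.

Independence of the signs bounds their characteristic function by `exp (-∑ z, 2 * q z * sin (M z *
θ) ^ 2)`, with `q = p * (1 - p)`. Convexity of `exp` with weights `K z / B` turns this exponential
of a sum into a sum of exponentials, and a one-dimensional integral (`integral_exp_mul_exp_sin_le`)
bounds the term at `z` by a constant times `spread K z / √(q z)`. This bound is linear in `1 / √q`,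
so it can be integrated over `μ`: by invariance every height contributes the integral assumed finite
(`wordMean_annealed_le`).

Typically `B` is of order `m`, and `K` is of order `√m` on about `√m` heights, so the sum of
`spread` is of order `m ^ (-3/4)`. The last `n` letters bring the height back with probability `O(n
^ (-1/2))`. The product of the two is the exponent `-5/4` (`wordMean_return_le`). -/

/-- The mean of `F` over the words of length `n` with letters in `α`. -/
def wordMean (α : Type*) [Fintype α] {V : Type*} [AddCommGroup V] [Module ℝ V] :
    ℕ → (List α → V) → V
  | 0, F => F []
  | n + 1, F => (Fintype.card α : ℝ)⁻¹ • ∑ a, wordMean α n fun w => F (a :: w)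

theorem wordMean_zero (F : List α → V) : wordMean α 0 F = F [] := rfl

theorem wordMean_succ (n : ℕ) (F : List α → V) :
    wordMean α (n + 1) F = (Fintype.card α : ℝ)⁻¹ • ∑ a, wordMean α n fun w => F (a :: w) := rfl

theorem wordMean_congr {n : ℕ} {F G : List α → V} (h : ∀ w, w.length = n → F w = G w) :
    wordMean α n F = wordMean α n G := by
  induction n generalizing F G with
  | zero => exact h [] rfl
  | succ n ih =>
    simp only [wordMean_succ]
    congr 1
    exact Finset.sum_congr rfl fun a _ => ih fun w hw => h _ (by simp [hw])

theorem wordMean_map {W : Type*} [AddCommGroup W] [Module ℝ W] (L : V →ₗ[ℝ] W) (n : ℕ)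
    (F : List α → V) : L (wordMean α n F) = wordMean α n fun w => L (F w) := by
  induction n generalizing F with
  | zero => rfl
  | succ n ih => simp [wordMean_succ, ih]

theorem wordMean_add (n : ℕ) (F G : List α → V) :
    wordMean α n (fun w => F w + G w) = wordMean α n F + wordMean α n G := by
  induction n generalizing F G with
  | zero => rfl
  | succ n ih => simp [wordMean_succ, ih, Finset.sum_add_distrib]

theorem wordMean_smul (n : ℕ) (c : ℝ) (F : List α → V) :
    wordMean α n (fun w => c • F w) = c • wordMean α n F :=
  (wordMean_map (LinearMap.lsmul ℝ V c) n F).symm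

theorem wordMean_finsetSum {ι : Type*} (s : Finset ι) (n : ℕ) (F : ι → List α → V) :
    wordMean α n (fun w => ∑ i ∈ s, F i w) = ∑ i ∈ s, wordMean α n (F i) := by
  induction n generalizing F with
  | zero => rfl
  | succ n ih =>
    simp only [wordMean_succ, ih, ← Finset.smul_sum]
    rw [Finset.sum_comm]

theorem wordMean_const_mul {A : Type*} [Ring A] [Algebra ℝ A] (n : ℕ) (c : A)
    (F : List α → A) : wordMean α n (fun w => c * F w) = c * wordMean α n F :=
  (wordMean_map (LinearMap.mulLeft ℝ c) n F).symm

theorem wordMean_mul_const {A : Type*} [Ring A] [Algebra ℝ A] (n : ℕ) (c : A)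
    (F : List α → A) : wordMean α n (fun w => F w * c) = wordMean α n F * c :=
  (wordMean_map (LinearMap.mulRight ℝ c) n F).symm

theorem wordMean_const [Nonempty α] (n : ℕ) (c : V) : wordMean α n (fun _ => c) = c := by
  induction n with
  | zero => rfl
  | succ n ih =>
    rw [wordMean_succ, ih, Finset.sum_const, Finset.card_univ, ← Nat.cast_smul_eq_nsmul ℝ,
      smul_smul, inv_mul_cancel₀ (by simp), one_smul]

theorem wordMean_append (m n : ℕ) (F : List α → V) :
    wordMean α (m + n) F = wordMean α m fun u => wordMean α n fun v => F (u ++ v) := by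
  induction m generalizing F with
  | zero => simp [wordMean_zero]
  | succ m ih =>
    rw [Nat.succ_add, wordMean_succ, wordMean_succ]
    congr 1
    exact Finset.sum_congr rfl fun a _ => ih _

theorem wordMean_comm {β : Type*} [Fintype β] (m n : ℕ) (F : List α → List β → V) :
    wordMean α m (fun u => wordMean β n (F u)) =
      wordMean β n fun v => wordMean α m fun u => F u v := by
  induction m generalizing F with
  | zero => rfl
  | succ m ih => simp only [wordMean_succ, ih, wordMean_smul, wordMean_finsetSum]

theorem wordMean_mono {n : ℕ} {F G : List α → ℝ} (h : ∀ w, w.length = n → F w ≤ G w) :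
    wordMean α n F ≤ wordMean α n G := by
  induction n generalizing F G with
  | zero => exact h [] rfl
  | succ n ih =>
    simp only [wordMean_succ, smul_eq_mul]
    gcongr with a
    exact ih fun w hw => h _ (by simp [hw])

theorem wordMean_nonneg {n : ℕ} {F : List α → ℝ} (h : ∀ w, 0 ≤ F w) : 0 ≤ wordMean α n F := by
  induction n generalizing F with
  | zero => exact h []
  | succ n ih =>
    rw [wordMean_succ, smul_eq_mul]
    exact mul_nonneg (by positivity) (Finset.sum_nonneg fun a _ => ih fun w => h _)

variable {Ω : Type*} [MeasurableSpace Ω] {ν : Measure Ω} {G : Type*} [NormedAddCommGroup G]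
  [NormedSpace ℝ G]

theorem integrable_wordMean {n : ℕ} {F : List α → Ω → G} (hF : ∀ w, Integrable (F w) ν) :
    Integrable (fun ω => wordMean α n fun w => F w ω) ν := by
  induction n generalizing F with
  | zero => exact hF []
  | succ n ih =>
    simp only [wordMean_succ]
    exact (integrable_finsetSum _ fun a _ => ih fun w => hF _).smul _

theorem integral_wordMean {n : ℕ} {F : List α → Ω → G} (hF : ∀ w, Integrable (F w) ν) :
    ∫ ω, wordMean α n (fun w => F w ω) ∂ν = wordMean α n fun w => ∫ ω, F w ω ∂ν := by
  induction n generalizing F with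
  | zero => rfl
  | succ n ih =>
    simp only [wordMean_succ]
    rw [integral_smul, integral_finsetSum _ fun a _ => integrable_wordMean fun w => hF _]
    congr 1
    exact Finset.sum_congr rfl fun a _ => ih fun w => hF _

theorem measurable_wordMean {n : ℕ} {F : List α → Ω → ℝ} (hF : ∀ w, Measurable (F w)) :
    Measurable (fun ω => wordMean α n fun w => F w ω) := by
  induction n generalizing F with
  | zero => exact hF []
  | succ n ih =>
    simp only [wordMean_succ, smul_eq_mul]
    exact (Finset.measurable_fun_sum _ fun a _ => ih fun w => hF _).const_mul _

end WordMean

theorem sum_signType {M : Type*} [AddCommMonoid M] (F : SignType → M) :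
    ∑ s, F s = F 0 + F (-1) + F 1 := by
  rw [SignType.univ_eq, Finset.sum_insert (by decide), Finset.sum_insert (by decide),
    Finset.sum_singleton, add_assoc]

theorem card_signType : Fintype.card SignType = 3 := rfl

/-! ### Words of moves

A move is a `SignType`: its vertical displacement, where `0` stands for a horizontal step. -/

/-- The vertical displacement along a word. -/
def rise (w : List SignType) : ℤ := (w.map fun s => (s : ℤ)).sum

@[simp] theorem rise_nil : rise [] = 0 := rfl

@[simp] theorem rise_cons (s : SignType) (w : List SignType) : rise (s :: w) = s + rise w := by
  simp [rise]

@[simp] theorem rise_append (v w : List SignType) : rise (v ++ w) = rise v + rise w := by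
  simp [rise]

/-- The number of horizontal steps made at each height, along a word that starts at height `y`. -/
def visits : ℤ → List SignType → (ℤ →₀ ℕ)
  | _, [] => 0
  | y, s :: w => (if s = 0 then Finsupp.single y 1 else 0) + visits (y + s) w

theorem visits_append (y : ℤ) (v w : List SignType) :
    visits y (v ++ w) = visits y v + visits (y + rise v) w := by
  induction v generalizing y with
  | nil => simp [visits]
  | cons s v ih => simp [visits, ih, add_assoc]

/-- The horizontal displacement due to `M z` steps at each height `z`. -/
def drift (ε : Orientation) (M : ℤ →₀ ℕ) : ℤ := M.sum fun z k => (k : ℤ) * (ε z : ℤ)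

@[simp] theorem drift_zero (ε : Orientation) : drift ε 0 = 0 := by simp [drift]

@[simp] theorem drift_add (ε : Orientation) (M N : ℤ →₀ ℕ) :
    drift ε (M + N) = drift ε M + drift ε N :=
  Finsupp.sum_add_index' (by simp) (by intros; push_cast; ring)

@[simp] theorem drift_single (ε : Orientation) (z : ℤ) (k : ℕ) :
    drift ε (Finsupp.single z k) = k * (ε z : ℤ) := by
  simp [drift]

/-! ### Flippable pairs of moves -/

/-- The pairs of moves "two horizontal steps" and "up, then down". -/
def Flippable (p : SignType × SignType) : Prop := p = (0, 0) ∨ p = (1, -1)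

instance : DecidablePred Flippable := fun p => by unfold Flippable; infer_instance

/-- A flippable pair is replaced by one of the two flippable pairs. -/
def flipBlock (p : SignType × SignType) (b : Bool) : List SignType :=
  if Flippable p then (if b then [0, 0] else [1, -1]) else [p.1, p.2]

/-- The word obtained from a list of pairs by replacing the flippable ones. -/
def resample (ps : List (SignType × SignType)) (bs : List Bool) : List SignType :=
  (List.zipWith flipBlock ps bs).flatten

@[simp] theorem resample_nil (bs : List Bool) : resample [] bs = [] := by simp [resample]

@[simp] theorem resample_cons (p : SignType × SignType) (ps : List (SignType × SignType))
    (b : Bool) (bs : List Bool) :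
    resample (p :: ps) (b :: bs) = flipBlock p b ++ resample ps bs := by simp [resample]

/-- The two flippable pairs carry equal mass `1/9`, so redrawing one of them by a fair coin
preserves the uniform law on pairs. A coin is drawn for every pair, even where it has no effect, so
that the coins have length `m` whatever the pairs are. -/
theorem wordMean_two_mul {V : Type*} [AddCommGroup V] [Module ℝ V] (m : ℕ)
    (F : List SignType → V) :
    wordMean SignType (2 * m) F = wordMean (SignType × SignType) m fun ps =>
      wordMean Bool m fun bs => F (resample ps bs) := by
  induction m generalizing F with
  | zero => simp [wordMean_zero]
  | succ m ih =>
    have h : ∀ (p : SignType × SignType) (b : Bool),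
        wordMean (SignType × SignType) m (fun ps => wordMean Bool m fun bs =>
          F (resample (p :: ps) (b :: bs))) =
        wordMean SignType (2 * m) fun w => F (flipBlock p b ++ w) := fun p b => by
      rw [ih]; simp
    rw [Nat.mul_succ]
    simp only [wordMean_succ, wordMean_smul, wordMean_finsetSum, h]
    simp only [Fintype.sum_prod_type, sum_signType, Fintype.sum_bool, Fintype.card_prod,
      card_signType, Fintype.card_bool]
    simp [flipBlock, Flippable]
    module

/-- The height reached along a list of pairs. -/
def pairRise (ps : List (SignType × SignType)) : ℤ := (ps.map fun p => (p.1 : ℤ) + p.2).sum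

@[simp] theorem pairRise_nil : pairRise [] = 0 := rfl

@[simp] theorem pairRise_cons (p : SignType × SignType) (ps : List (SignType × SignType)) :
    pairRise (p :: ps) = p.1 + p.2 + pairRise ps := by
  simp [pairRise]

theorem rise_flipBlock (p : SignType × SignType) (b : Bool) :
    rise (flipBlock p b) = p.1 + p.2 := by
  unfold flipBlock
  split_ifs with h hb
  · rcases h with rfl | rfl <;> simp
  · rcases h with rfl | rfl <;> simp
  · simp

theorem rise_resample (ps : List (SignType × SignType)) (bs : List Bool)
    (h : bs.length = ps.length) : rise (resample ps bs) = pairRise ps := by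
  induction ps generalizing bs with
  | nil => simp
  | cons p ps ih =>
    match bs, h with
    | b :: bs, h => simp [rise_flipBlock, ih bs (by simpa using h)]

/-- The number of flippable pairs met at each height. -/
def flips : ℤ → List (SignType × SignType) → (ℤ →₀ ℕ)
  | _, [] => 0
  | y, p :: ps => (if Flippable p then Finsupp.single y 1 else 0) + flips (y + (p.1 + p.2)) ps

/-- The mean number of horizontal steps made at each height, when the flippable pairs are
resampled. -/
def meanVisits : ℤ → List (SignType × SignType) → (ℤ →₀ ℕ)
  | _, [] => 0
  | y, p :: ps => (if Flippable p then Finsupp.single y 1 else visits y [p.1, p.2]) +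
      meanVisits (y + (p.1 + p.2)) ps

theorem flips_le_meanVisits (y : ℤ) (ps : List (SignType × SignType)) :
    flips y ps ≤ meanVisits y ps := by
  induction ps generalizing y with
  | nil => exact le_rfl
  | cons p ps ih =>
    rw [flips, meanVisits]
    refine add_le_add ?_ (ih _)
    split_ifs
    · exact le_rfl
    · exact bot_le

theorem degree_flips (y : ℤ) (ps : List (SignType × SignType)) :
    (flips y ps).degree = ps.countP (fun p => Flippable p) := by
  induction ps generalizing y with
  | nil => simp [flips]
  | cons p ps ih =>
    rw [flips, map_add, ih, List.countP_cons, add_comm]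
    split_ifs <;> simp_all

-- A resampled pair at height `y` shifts the drift by `0` or `2 * ε y`, and `(1 + exp (2iθ ε)) / 2 =
-- cos θ * exp (iθ ε)`. As `cos` is even, the factor `cos θ` does not depend on `ε` and comes out of
-- any later integration over orientations.
open Complex in
theorem wordMean_cexp_drift (ε : Orientation) (θ : ℝ) (y : ℤ) (ps : List (SignType × SignType))
    (w : List SignType) :
    wordMean Bool ps.length
      (fun bs => cexp (θ * (drift ε (visits y (resample ps bs ++ w)) : ℂ) * Complex.I)) =
    (cos θ) ^ (flips y ps).degree *
      cexp (θ * (drift ε (meanVisits y ps + visits (y + pairRise ps) w) : ℂ) * Complex.I) := by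
  induction ps generalizing y with
  | nil => simp [wordMean_zero, flips, meanVisits]
  | cons p ps ih =>
    rw [List.length_cons, wordMean_succ]
    have hb : ∀ (b : Bool) (bs : List Bool),
        cexp (θ * (drift ε (visits y (resample (p :: ps) (b :: bs) ++ w)) : ℂ) * Complex.I) =
        cexp (θ * (drift ε (visits y (flipBlock p b)) : ℂ) * Complex.I) *
        cexp (θ * (drift ε (visits (y + (p.1 + p.2)) (resample ps bs ++ w)) : ℂ) * Complex.I) := by
      intro b bs
      rw [resample_cons, List.append_assoc, visits_append, drift_add, rise_flipBlock,
        ← Complex.exp_add]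
      congr 1
      push_cast
      ring
    simp only [hb, wordMean_const_mul, ih, Fintype.sum_bool, Fintype.card_bool]
    rw [flips, meanVisits, pairRise_cons]
    simp only [map_add, drift_add, add_assoc, ← add_mul]
    by_cases h : Flippable p
    · have he : drift ε (visits y (flipBlock p true)) = 2 * (ε y : ℤ) := by
        simp [flipBlock, h, visits]; ring
      have he' : drift ε (visits y (flipBlock p false)) = 0 := by
        simp [flipBlock, h, visits]
      have hc : cexp (θ * (2 * (ε y : ℤ) : ℤ) * Complex.I) + 1 =
          2 * (cos θ * cexp (θ * (ε y : ℤ) * Complex.I)) := by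
        have h2 : cos (θ : ℂ) = cos (θ * (ε y : ℤ)) := by
          rcases Int.units_eq_one_or (ε y) with h | h <;> simp [h]
        rw [h2, Complex.cos]
        have : θ * ((2 * (ε y : ℤ) : ℤ) : ℂ) * Complex.I = θ * (ε y : ℤ) * Complex.I + θ * (ε y : ℤ) * Complex.I := by
          push_cast; ring
        rw [this, Complex.exp_add]
        have hx : cexp (-(θ * (ε y : ℤ)) * Complex.I) * cexp (θ * (ε y : ℤ) * Complex.I) = 1 := by
          rw [← Complex.exp_add]; simp
        linear_combination -hx
      rw [if_pos h, if_pos h, he, he']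
      simp only [Int.cast_zero, mul_zero, zero_mul, Complex.exp_zero, hc, drift_single,
        Finsupp.degree_single, pow_add, Int.cast_add, mul_add, add_mul, Complex.exp_add]
      simp
      ring
    · have he : ∀ b, visits y (flipBlock p b) = visits y [p.1, p.2] := by
        simp [flipBlock, h]
      rw [if_neg h, if_neg h]
      simp only [he, map_zero, zero_add, Int.cast_add, mul_add, add_mul, Complex.exp_add]
      simp
      ring

/-! ### Sums of the Cauchy profile over the integers -/

theorem integral_inv_one_add_mul_sq {a : ℝ} (ha : 0 < a) (n : ℕ) :
    ∫ x in (0 : ℝ)..n, (1 + a * x ^ 2)⁻¹ ≤ 2 / √a := by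
  have hs : 0 < √a := Real.sqrt_pos.2 ha
  have h1 : ∀ x : ℝ, (1 + a * x ^ 2)⁻¹ = (fun u : ℝ => (1 + u ^ 2)⁻¹) (√a * x) := by
    intro x
    simp only [mul_pow, Real.sq_sqrt ha.le]
  simp only [h1]
  rw [intervalIntegral.integral_comp_mul_left (fun u : ℝ => (1 + u ^ 2)⁻¹) hs.ne',
    integral_inv_one_add_sq, smul_eq_mul, mul_zero, Real.arctan_zero, sub_zero, inv_mul_eq_div]
  gcongr
  linarith [Real.arctan_lt_pi_div_two (√a * n), Real.pi_lt_four]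

theorem sum_range_inv_one_add_mul_sq_le {a : ℝ} (ha : 0 < a) (n : ℕ) :
    ∑ i ∈ Finset.range n, (1 + a * ((i + 1 : ℕ) : ℝ) ^ 2)⁻¹ ≤ 2 / √a := by
  have hanti : AntitoneOn (fun x : ℝ => (1 + a * x ^ 2)⁻¹) (Set.Icc 0 (0 + n)) := by
    intro x hx y _ hxy
    have := hx.1
    beta_reduce
    gcongr
  have := hanti.sum_le_integral
  simp only [zero_add] at this
  exact this.trans (integral_inv_one_add_mul_sq ha n)

/-- The centre `z = y` contributes `1`, and each half-line is compared with an arctangent integral,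
which is at most `π / (2√a) ≤ 2 / √a`. -/
theorem sum_inv_one_add_mul_sq_le {a : ℝ} (ha : 0 < a) (y : ℤ) (s : Finset ℤ) :
    ∑ z ∈ s, (1 + a * ((z - y : ℤ) : ℝ) ^ 2)⁻¹ ≤ 1 + 4 / √a := by
  have hnn : ∀ i : ℕ, 0 ≤ (1 + a * ((i + 1 : ℕ) : ℝ) ^ 2)⁻¹ := fun i => by positivity
  have hsum : Summable fun i : ℕ => (1 + a * ((i + 1 : ℕ) : ℝ) ^ 2)⁻¹ :=
    summable_of_sum_range_le hnn (sum_range_inv_one_add_mul_sq_le ha)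
  have htsum : ∑' i : ℕ, (1 + a * ((i + 1 : ℕ) : ℝ) ^ 2)⁻¹ ≤ 2 / √a :=
    Real.tsum_le_of_sum_range_le hnn (sum_range_inv_one_add_mul_sq_le ha)
  let g : ℤ → ℝ := fun z => (1 + a * (z : ℝ) ^ 2)⁻¹
  have h1 : HasSum (fun n : ℕ => g n)
      (∑' i : ℕ, (1 + a * ((i + 1 : ℕ) : ℝ) ^ 2)⁻¹ + 1) := by
    have := (hasSum_nat_add_iff (f := fun n : ℕ => g n) 1).1
      (by simpa only [g, Int.cast_natCast] using hsum.hasSum)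
    simpa [g] using this
  have h2 : HasSum (fun n : ℕ => g (-(n + 1))) (∑' i : ℕ, (1 + a * ((i + 1 : ℕ) : ℝ) ^ 2)⁻¹) := by
    convert hsum.hasSum using 2 with n
    simp only [g]
    push_cast
    ring
  have h3 := h1.of_nat_of_neg_add_one h2
  have h4 := (Equiv.subRight y).hasSum_iff.2 h3
  refine (sum_le_hasSum s (fun z _ => ?_) h4).trans ?_
  · simp only [g, Function.comp]
    positivity
  · have : 4 / √a = 2 / √a + 2 / √a := by ring
    linarith

/-! ### The law of the height -/

open Complex in
theorem indicator_eq_integral_cexp (k : ℤ) :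
    (if k = 0 then 1 else 0 : ℂ) =
      (2 * Real.pi : ℂ)⁻¹ * ∫ θ in (-Real.pi)..Real.pi, cexp (θ * (k : ℂ) * Complex.I) := by
  have hpi : (Real.pi : ℂ) ≠ 0 := by exact_mod_cast Real.pi_ne_zero
  split_ifs with h
  · subst h
    simp only [Int.cast_zero, mul_zero, zero_mul, Complex.exp_zero,
      intervalIntegral.integral_const]
    rw [Complex.real_smul]
    push_cast
    field_simp
    norm_num
  · have hk : (k : ℂ) * Complex.I ≠ 0 := by simpa using h
    have : ∀ θ : ℝ, cexp (θ * (k : ℂ) * Complex.I) = cexp ((k : ℂ) * Complex.I * θ) := fun θ => by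
      congr 1; ring
    simp only [this]
    rw [integral_exp_mul_complex hk]
    have h2 : cexp (k * Complex.I * (Real.pi : ℝ)) = cexp (k * Complex.I * ((-Real.pi : ℝ) : ℂ)) := by
      rw [Complex.exp_eq_exp_iff_exists_int]
      exact ⟨k, by push_cast; ring⟩
    rw [h2, sub_self, zero_div, mul_zero]

open Complex in
theorem wordMean_cexp_rise (θ : ℝ) (n : ℕ) :
    wordMean SignType n (fun w => cexp (θ * (rise w : ℂ) * Complex.I)) =
      (((1 + 2 * Real.cos θ) / 3 : ℝ) : ℂ) ^ n := by
  induction n with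
  | zero => simp [wordMean_zero]
  | succ n ih =>
    have h : ∀ (s : SignType) w, cexp (θ * (rise (s :: w) : ℂ) * Complex.I) =
        cexp (θ * ((s : ℤ) : ℂ) * Complex.I) * cexp (θ * (rise w : ℂ) * Complex.I) := by
      intro s w
      rw [rise_cons, ← Complex.exp_add]
      congr 1
      push_cast
      ring
    simp only [wordMean_succ, h, wordMean_const_mul, ih, ← Finset.sum_mul, sum_signType,
      card_signType]
    simp [Complex.cos, pow_succ]
    ring

/-- The steps may be horizontal, so the walk of heights is aperiodic: its characteristic function is
at least `-1/3` and has modulus `1` only at `θ = 0` in this range. The constant `10` serves both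
signs, since `π ^ 2 ≤ 10` and `1/3 ≤ exp (-1)`. -/
theorem abs_one_add_two_mul_cos_le {θ : ℝ} (h : |θ| ≤ Real.pi) :
    |(1 + 2 * Real.cos θ) / 3| ≤ Real.exp (-(θ ^ 2 / 10)) := by
  have hpi : Real.pi ^ 2 ≤ 10 := by nlinarith [Real.pi_lt_d2, Real.pi_pos]
  have hθ : θ ^ 2 ≤ Real.pi ^ 2 := sq_le_sq' (abs_le.1 h).1 (abs_le.1 h).2
  rw [abs_le]
  constructor
  · have h1 : Real.exp (-1) ≤ Real.exp (-(θ ^ 2 / 10)) := Real.exp_le_exp.2 (by linarith)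
    have h2 : 1 / 3 ≤ Real.exp (-1) := by
      rw [Real.exp_neg, ← one_div]
      gcongr
      linarith [Real.exp_one_lt_d9]
    linarith [Real.neg_one_le_cos θ]
  · have h1 := Real.cos_le_one_sub_mul_cos_sq h
    have h2 : θ ^ 2 / 10 ≤ 4 / (3 * Real.pi ^ 2) * θ ^ 2 := by
      have : (1 : ℝ) / 10 ≤ 4 / (3 * Real.pi ^ 2) := by
        rw [div_le_div_iff₀ (by norm_num) (by positivity)]
        linarith
      nlinarith [sq_nonneg θ]
    have h3 := Real.add_one_le_exp (-(θ ^ 2 / 10))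
    have h4 : (1 + 2 * (1 - 2 / Real.pi ^ 2 * θ ^ 2)) / 3 = 1 - 4 / (3 * Real.pi ^ 2) * θ ^ 2 := by
      field_simp
      ring
    linarith

open Complex in
theorem wordMean_rise_eq_le (n : ℕ) (z : ℤ) :
    wordMean SignType n (fun w => if rise w = z then (1 : ℝ) else 0) ≤ 3 / √(n + 1 : ℝ) := by
  have hn : (0 : ℝ) < n + 1 := by positivity
  have h1 : ((wordMean SignType n (fun w => if rise w = z then (1 : ℝ) else 0) : ℝ) : ℂ) =
      (2 * Real.pi : ℂ)⁻¹ * ∫ θ in (-Real.pi)..Real.pi,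
        (((1 + 2 * Real.cos θ) / 3 : ℝ) : ℂ) ^ n * cexp (-(θ * z * Complex.I)) := by
    have h := wordMean_map Complex.ofRealCLM.toLinearMap n
      (fun w : List SignType => if rise w = z then (1 : ℝ) else 0)
    change ((wordMean SignType n (fun w => if rise w = z then (1 : ℝ) else 0) : ℝ) : ℂ) =
      wordMean SignType n (fun w => ((if rise w = z then (1 : ℝ) else 0 : ℝ) : ℂ)) at h
    rw [h]
    have h' : ∀ w : List SignType, ((if rise w = z then (1 : ℝ) else 0 : ℝ) : ℂ) =
        (2 * Real.pi : ℂ)⁻¹ * ∫ θ in (-Real.pi)..Real.pi,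
          cexp (θ * ((rise w - z : ℤ) : ℂ) * Complex.I) := by
      intro w
      rw [← indicator_eq_integral_cexp]
      simp only [sub_eq_zero]
      split_ifs <;> simp
    simp only [h', wordMean_const_mul]
    congr 1
    simp only [intervalIntegral.integral_of_le (by linarith [Real.pi_pos] : -Real.pi ≤ Real.pi)]
    rw [← integral_wordMean]
    · congr 1 with θ
      rw [← wordMean_cexp_rise, ← wordMean_mul_const]
      congr 1 with w
      rw [← Complex.exp_add]
      congr 1
      push_cast
      ring
    · intro w
      exact (Continuous.integrableOn_Icc (by fun_prop)).mono_set Set.Ioc_subset_Icc_self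
  have h2 : ‖((wordMean SignType n (fun w => if rise w = z then (1 : ℝ) else 0) : ℝ) : ℂ)‖ ≤
      (2 * Real.pi)⁻¹ * ∫ θ in (-Real.pi)..Real.pi,
        Real.exp 1 * Real.exp (-((n + 1) / 10) * θ ^ 2) := by
    rw [h1, norm_mul]
    have : ‖(2 * Real.pi : ℂ)⁻¹‖ = (2 * Real.pi)⁻¹ := by
      rw [norm_inv, norm_mul, Complex.norm_real, Real.norm_of_nonneg Real.pi_pos.le]
      simp
    rw [this]
    gcongr
    refine intervalIntegral.norm_integral_le_of_norm_le (by linarith [Real.pi_pos]) ?_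
      (Continuous.intervalIntegrable (by fun_prop) _ _)
    refine Filter.Eventually.of_forall fun θ hθ => ?_
    have hθ' : |θ| ≤ Real.pi := abs_le.2 ⟨hθ.1.le, hθ.2⟩
    have hpi : Real.pi ^ 2 ≤ 10 := by nlinarith [Real.pi_lt_d2, Real.pi_pos]
    have hθ2 : θ ^ 2 ≤ Real.pi ^ 2 := sq_le_sq' (abs_le.1 hθ').1 (abs_le.1 hθ').2
    have he : ‖cexp (-(θ * z * Complex.I))‖ = 1 := by
      rw [Complex.norm_exp]; simp
    rw [norm_mul, he, mul_one, norm_pow, Complex.norm_real, Real.norm_eq_abs]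
    refine (pow_le_pow_left₀ (abs_nonneg _) (abs_one_add_two_mul_cos_le hθ') n).trans ?_
    rw [← Real.exp_nat_mul, ← Real.exp_add]
    -- Since `θ ^ 2 / 10 ≤ 1`, the factor `exp 1` pays for replacing `n` by `n + 1`, which makes the
    -- bound valid at `n = 0` too.
    refine Real.exp_le_exp.2 ?_
    linarith
  have h3 : ∫ θ in (-Real.pi)..Real.pi, Real.exp 1 * Real.exp (-((n + 1) / 10) * θ ^ 2) ≤
      Real.exp 1 * √(Real.pi / ((n + 1) / 10)) := by
    rw [intervalIntegral.integral_const_mul, ← integral_gaussian,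
      intervalIntegral.integral_of_le (by linarith [Real.pi_pos])]
    refine mul_le_mul_of_nonneg_left ?_ (Real.exp_pos _).le
    refine setIntegral_le_integral (integrable_exp_neg_mul_sq (by positivity)) ?_
    exact Filter.Eventually.of_forall fun θ => (Real.exp_pos _).le
  rw [Complex.norm_real, Real.norm_eq_abs] at h2
  refine ((le_abs_self _).trans h2).trans ?_
  have h4 : √(Real.pi / ((n + 1) / 10)) ≤ 6 / √(n + 1 : ℝ) := by
    rw [Real.sqrt_le_left (by positivity), div_pow, Real.sq_sqrt hn.le, div_div_eq_mul_div]
    gcongr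
    linarith [Real.pi_lt_d2]
  have h5 : (2 * Real.pi)⁻¹ * (Real.exp 1 * (6 / √(n + 1 : ℝ))) =
      (6 * Real.exp 1) / (2 * Real.pi) / √(n + 1 : ℝ) := by
    field_simp
  refine (mul_le_mul_of_nonneg_left (h3.trans (mul_le_mul_of_nonneg_left h4 (Real.exp_pos _).le))
    (by positivity)).trans ?_
  rw [h5]
  gcongr
  rw [div_le_iff₀ (by positivity)]
  linarith [Real.exp_one_lt_d9, Real.pi_gt_d2]

theorem wordMean_pairRise (m : ℕ) (g : ℤ → ℝ) :
    wordMean (SignType × SignType) m (fun ps => g (pairRise ps)) =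
      wordMean SignType (2 * m) fun w => g (rise w) := by
  rw [wordMean_two_mul]
  refine wordMean_congr fun ps hps => ?_
  rw [← wordMean_const (α := Bool) m (g (pairRise ps))]
  refine wordMean_congr fun bs hbs => ?_
  rw [rise_resample _ _ (by omega)]

theorem wordMean_pairRise_eq_le (m : ℕ) (z : ℤ) :
    wordMean (SignType × SignType) m (fun ps => if pairRise ps = z then (1 : ℝ) else 0) ≤
      3 / √(m + 1 : ℝ) := by
  rw [wordMean_pairRise m fun r => if r = z then (1 : ℝ) else 0]
  refine (wordMean_rise_eq_le _ z).trans ?_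
  gcongr
  linarith [(Nat.cast_nonneg m : (0 : ℝ) ≤ m)]

/-! ### Local times of the flippable pairs -/

theorem sum_pairs (g : SignType × SignType → ℝ) :
    ∑ p, g p = g (0, 0) + g (0, -1) + g (0, 1) + (g (-1, 0) + g (-1, -1) + g (-1, 1)) +
      (g (1, 0) + g (1, -1) + g (1, 1)) := by
  simp only [Fintype.sum_prod_type, sum_signType]

theorem card_pairs : Fintype.card (SignType × SignType) = 9 := rfl

theorem wordMean_pairs_succ_le {n : ℕ} {F : List (SignType × SignType) → ℝ} {c : ℝ}
    (h : ∀ p, wordMean (SignType × SignType) n (fun ps => F (p :: ps)) ≤ c) :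
    wordMean (SignType × SignType) (n + 1) F ≤ c := by
  rw [wordMean_succ, card_pairs, smul_eq_mul]
  calc ((9 : ℕ) : ℝ)⁻¹ * ∑ p, wordMean (SignType × SignType) n (fun ps => F (p :: ps))
      ≤ ((9 : ℕ) : ℝ)⁻¹ * ∑ _p : SignType × SignType, c := by
        gcongr with p
        exact h p
    _ = c := by
        rw [Finset.sum_const, Finset.card_univ, card_pairs, nsmul_eq_mul, ← mul_assoc,
          inv_mul_cancel₀ (by norm_num), one_mul]

/-- A flippable pair counted at `z` starts at height `z`; forgetting flippability leaves the
expected local time of the walk of pair heights. -/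
theorem wordMean_flips_le_sum (m : ℕ) (y z : ℤ) :
    wordMean (SignType × SignType) m (fun ps => (flips y ps z : ℝ)) ≤
      ∑ k ∈ Finset.range m, wordMean (SignType × SignType) k
        (fun ps => if pairRise ps = z - y then (1 : ℝ) else 0) := by
  induction m generalizing y with
  | zero => simp [wordMean_zero, flips]
  | succ m ih =>
    have h1 : ∀ p ps, (flips y (p :: ps) z : ℝ) ≤
        (if z - y = 0 then 1 else 0) + (flips (y + (p.1 + p.2)) ps z : ℝ) := by
      intro p ps
      rw [flips, Finsupp.add_apply]
      push_cast
      gcongr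
      by_cases hp : Flippable p
      · rw [if_pos hp, Finsupp.single_apply]
        by_cases hz : z - y = 0
        · rw [if_pos hz]; split_ifs <;> simp
        · rw [if_neg hz, if_neg (by omega)]; simp
      · rw [if_neg hp]; split_ifs <;> simp
    have h2 : ∀ p, wordMean (SignType × SignType) m (fun ps => (flips y (p :: ps) z : ℝ)) ≤
        (if z - y = 0 then 1 else 0) + ∑ k ∈ Finset.range m,
          wordMean (SignType × SignType) k
            (fun ps => if pairRise (p :: ps) = z - y then (1 : ℝ) else 0) := by
      intro p
      refine (wordMean_mono fun ps _ => h1 p ps).trans ?_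
      rw [wordMean_add, wordMean_const]
      gcongr
      refine (ih _).trans (le_of_eq ?_)
      congr 1 with k
      congr 1 with ps
      rw [pairRise_cons]
      congr 1
      exact propext ⟨fun h => by omega, fun h => by omega⟩
    rw [wordMean_succ, Finset.sum_range_succ']
    have h0 : wordMean (SignType × SignType) 0
        (fun ps => if pairRise ps = z - y then (1 : ℝ) else 0) = if z - y = 0 then 1 else 0 := by
      rw [wordMean_zero]
      exact if_congr (by rw [pairRise_nil, eq_comm]) rfl rfl
    rw [h0]
    simp only [wordMean_succ]
    rw [← Finset.smul_sum, card_pairs, smul_eq_mul, smul_eq_mul, Finset.sum_comm]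
    have h3 : ((9 : ℕ) : ℝ)⁻¹ * ∑ _p : SignType × SignType, (if z - y = 0 then (1 : ℝ) else 0) =
        if z - y = 0 then (1 : ℝ) else 0 := by
      rw [Finset.sum_const, Finset.card_univ, card_pairs, nsmul_eq_mul, ← mul_assoc,
        inv_mul_cancel₀ (by norm_num), one_mul]
    rw [← h3, ← mul_add, ← Finset.sum_add_distrib]
    gcongr with p
    rw [add_comm]
    exact h2 p

theorem sum_range_inv_sqrt_le (m : ℕ) :
    ∑ k ∈ Finset.range m, 3 / √(k + 1 : ℝ) ≤ 6 * √m := by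
  induction m with
  | zero => simp
  | succ m ih =>
    rw [Finset.sum_range_succ]
    push_cast
    have hb : 0 < √(m + 1 : ℝ) := by positivity
    have h1 : √(m : ℝ) ^ 2 = m := Real.sq_sqrt (by positivity)
    have h2 : √(m + 1 : ℝ) ^ 2 = m + 1 := Real.sq_sqrt (by positivity)
    have h3 : 3 / √(m + 1 : ℝ) ≤ 6 * √(m + 1 : ℝ) - 6 * √m := by
      rw [div_le_iff₀ hb]
      nlinarith [sq_nonneg (√(m + 1 : ℝ) - √m)]
    linarith

theorem wordMean_flips_le (m : ℕ) (y z : ℤ) :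
    wordMean (SignType × SignType) m (fun ps => (flips y ps z : ℝ)) ≤ 6 * √m :=
  (wordMean_flips_le_sum m y z).trans <|
    (Finset.sum_le_sum fun k _ => wordMean_pairRise_eq_le k _).trans (sum_range_inv_sqrt_le m)

theorem sum_sq_single_add (y : ℤ) (K : ℤ →₀ ℕ) :
    (Finsupp.single y 1 + K).sum (fun _ k => (k : ℝ) ^ 2) =
      K.sum (fun _ k => (k : ℝ) ^ 2) + (1 + 2 * K y) := by
  classical
  have h1 : (Finsupp.single y 1 + K).support ⊆ insert y K.support := by
    intro z hz
    simp only [Finsupp.mem_support_iff, Finsupp.add_apply, Finsupp.single_apply] at hz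
    simp only [Finset.mem_insert, Finsupp.mem_support_iff]
    by_cases h : y = z
    · exact Or.inl h.symm
    · rw [if_neg h] at hz; exact Or.inr (by omega)
  rw [Finsupp.sum_of_support_subset _ h1 _ (by simp),
    Finsupp.sum_of_support_subset K (Finset.subset_insert y K.support) _ (by simp)]
  have h2 : ∀ z ∈ insert y K.support, ((Finsupp.single y 1 + K : ℤ →₀ ℕ) z : ℝ) ^ 2 =
      (K z : ℝ) ^ 2 + if y = z then (1 + 2 * (K y : ℝ)) else 0 := by
    intro z _
    rw [Finsupp.add_apply, Finsupp.single_apply]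
    split_ifs with h
    · subst h; push_cast; ring
    · simp
  rw [Finset.sum_congr rfl h2, Finset.sum_add_distrib, Finset.sum_ite_eq,
    if_pos (Finset.mem_insert_self _ _)]

/-- Peeling off the first pair raises the sum of squares by at most `1 + 2 * K y`, where `K` counts
the remaining pairs and has mean at most `6 * √m`. Fixing `m` keeps this increment uniform along the
induction on `n`. -/
theorem wordMean_sum_sq_flips_le {m n : ℕ} (h : n ≤ m) (y : ℤ) :
    wordMean (SignType × SignType) n (fun ps => (flips y ps).sum fun _ k => (k : ℝ) ^ 2) ≤
      n * (1 + 12 * √m) := by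
  induction n generalizing y with
  | zero => simp [wordMean_zero, flips]
  | succ n ih =>
    refine wordMean_pairs_succ_le fun p => ?_
    have h1 : ∀ ps, ((flips y (p :: ps)).sum fun _ k => (k : ℝ) ^ 2) ≤
        ((flips (y + (p.1 + p.2)) ps).sum fun _ k => (k : ℝ) ^ 2) +
          (1 + 2 * (flips (y + (p.1 + p.2)) ps y : ℝ)) := by
      intro ps
      rw [flips]
      split_ifs with hp
      · exact (sum_sq_single_add y _).le
      · rw [zero_add]
        linarith [(Nat.cast_nonneg (flips (y + (p.1 + p.2)) ps y) : (0 : ℝ) ≤ _)]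
    refine (wordMean_mono fun ps _ => h1 ps).trans ?_
    rw [wordMean_add, wordMean_add, wordMean_const, wordMean_const_mul]
    have h2 := wordMean_flips_le n (y + (p.1 + p.2)) y
    have h3 : √(n : ℝ) ≤ √m := Real.sqrt_le_sqrt (by exact_mod_cast (by omega : n ≤ m))
    have h4 := ih (by omega) (y + (p.1 + p.2))
    push_cast
    linarith

/-- The height is a centred walk of variance `4/3` per pair, so its squared distance to `y₀` grows
at most linearly in mean. The reference `y₀` stays fixed while the induction moves the start `y`. -/
theorem wordMean_sum_sq_mul_flips_le (m : ℕ) (y₀ y : ℤ) :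
    wordMean (SignType × SignType) m
      (fun ps => (flips y ps).sum fun z k => (k : ℝ) * ((z - y₀ : ℤ) : ℝ) ^ 2) ≤
      m * (((y - y₀ : ℤ) : ℝ) ^ 2 + 2 * m) := by
  induction m generalizing y with
  | zero => simp [wordMean_zero, flips]
  | succ m ih =>
    have h1 : ∀ p, wordMean (SignType × SignType) m (fun ps =>
        (flips y (p :: ps)).sum fun z k => (k : ℝ) * ((z - y₀ : ℤ) : ℝ) ^ 2) ≤
        ((y - y₀ : ℤ) : ℝ) ^ 2 +
          m * (((y + (p.1 + p.2) - y₀ : ℤ) : ℝ) ^ 2 + 2 * m) := by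
      intro p
      refine le_trans (wordMean_mono (G := fun ps => ((y - y₀ : ℤ) : ℝ) ^ 2 +
        (flips (y + (p.1 + p.2)) ps).sum fun z k => (k : ℝ) * ((z - y₀ : ℤ) : ℝ) ^ 2)
        fun ps _ => ?_) ?_
      · rw [flips, Finsupp.sum_add_index' (by simp) (by intros; push_cast; ring)]
        gcongr
        split_ifs
        · simp
        · simp [sq_nonneg]
      · rw [wordMean_add, wordMean_const]
        gcongr
        exact ih _
    rw [wordMean_succ, card_pairs, smul_eq_mul]
    refine (mul_le_mul_of_nonneg_left (Finset.sum_le_sum fun p _ => h1 p) (by positivity)).trans ?_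
    rw [sum_pairs]
    push_cast
    simp
    nlinarith [(Nat.cast_nonneg m : (0 : ℝ) ≤ m)]

theorem wordMean_pow_countP (c : ℝ) (m : ℕ) :
    wordMean (SignType × SignType) m (fun ps => c ^ ps.countP (fun p => Flippable p)) =
      (7 / 9 + 2 / 9 * c) ^ m := by
  induction m with
  | zero => simp [wordMean_zero]
  | succ m ih =>
    have h : ∀ p ps, c ^ (List.countP (fun p => decide (Flippable p)) (p :: ps)) =
        (if Flippable p then c else 1) * c ^ (ps.countP (fun p => Flippable p)) := by
      intro p ps
      rw [List.countP_cons, pow_add, mul_comm]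
      by_cases hp : Flippable p <;> simp [hp]
    simp only [wordMean_succ, h, wordMean_const_mul, ih, ← Finset.sum_mul, smul_eq_mul, sum_pairs,
      card_pairs]
    simp [Flippable]
    ring

/-- A proportion `2/9` of the pairs is flippable on average, so a proportion below `1/10` is a large
deviation. This is a Chernoff bound with weight `(8/9) ^ 10` per flippable pair; the resulting
geometric decay is weakened to `1 / (m + 1)`, which is all that is needed. -/
theorem wordMean_degree_flips_lt_le (m : ℕ) (y : ℤ) :
    wordMean (SignType × SignType) m
      (fun ps => if 10 * (flips y ps).degree < m + 1 then (1 : ℝ) else 0) ≤ 27 / (m + 1) := by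
  have h1 : ∀ ps : List (SignType × SignType),
      (if 10 * (flips y ps).degree < m + 1 then (1 : ℝ) else 0) ≤
        (9 / 8) ^ (m + 1) * ((8 / 9) ^ 10) ^ ps.countP (fun p => Flippable p) := by
    intro ps
    rw [degree_flips]
    split_ifs with h
    · rw [← pow_mul]
      calc (1 : ℝ) = (9 / 8) ^ (m + 1) * (8 / 9) ^ (m + 1) := by rw [← mul_pow]; norm_num
        _ ≤ _ := by
          gcongr ?_ * ?_
          exact pow_le_pow_of_le_one (by norm_num) (by norm_num) h.le
    · positivity
  refine (wordMean_mono fun ps _ => h1 ps).trans ?_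
  rw [wordMean_const_mul, wordMean_pow_countP, pow_succ, mul_assoc, mul_comm (9 / 8 : ℝ),
    ← mul_assoc, ← mul_pow]
  have h2 : ((9 / 8 : ℝ) * (7 / 9 + 2 / 9 * (8 / 9) ^ 10)) ^ m ≤ (24 / 25) ^ m := by
    gcongr
    norm_num
  have h3 : (24 / 25 : ℝ) ^ m ≤ 24 / (m + 1) := by
    have h4 := one_add_mul_le_pow (a := (1 / 24 : ℝ)) (by norm_num) m
    have h5 : (24 / 25 : ℝ) ^ m = ((1 + 1 / 24) ^ m)⁻¹ := by rw [← inv_pow]; norm_num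
    rw [h5, inv_le_comm₀ (by positivity) (by positivity), inv_div]
    refine le_trans ?_ h4
    rw [div_le_iff₀ (by norm_num)]
    linarith
  calc _ ≤ 24 / ((m : ℝ) + 1) * (9 / 8) := by gcongr; exact h2.trans h3
    _ = 27 / (m + 1) := by ring

theorem sqrt_mul_le_add_div_two {a b : ℝ} (ha : 0 ≤ a) (hb : 0 ≤ b) : √(a * b) ≤ (a + b) / 2 := by
  rw [Real.sqrt_le_left (by positivity)]
  nlinarith [sq_nonneg (a - b)]

/-- With `s = (m + 1) ^ (1/4)`, both the local times and the range of heights have typical size `s ^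
2`, whence the order `s ^ 2 * s`. A weighted AM-GM inequality localises the sum at scale `s ^ 2`
around `y`. -/
theorem wordMean_sum_sqrt_flips_le (m : ℕ) (y : ℤ) {s : ℝ} (hs : 0 < s) (hsm : s ^ 4 = m + 1) :
    wordMean (SignType × SignType) m (fun ps => (flips y ps).sum fun _ k => √(k : ℝ)) ≤
      4 * s ^ 3 := by
  have hs1 : 1 ≤ s := by
    by_contra! h
    have := pow_lt_one₀ hs.le h (n := 4) (by norm_num)
    linarith [(Nat.cast_nonneg m : (0 : ℝ) ≤ m)]
  have h1 : ∀ K : ℤ →₀ ℕ, (K.sum fun _ k => √(k : ℝ)) ≤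
      (2 * s)⁻¹ * K.degree +
      (2 * s ^ 5)⁻¹ * (K.sum fun z k => (k : ℝ) * ((z - y : ℤ) : ℝ) ^ 2) + 5 / 2 * s ^ 3 := by
    intro K
    have h2 : ∀ z, √(K z : ℝ) ≤ (2 * s)⁻¹ * (K z : ℝ) +
        (2 * s ^ 5)⁻¹ * ((K z : ℝ) * ((z - y : ℤ) : ℝ) ^ 2) +
        s / 2 * (1 + (s ^ 4)⁻¹ * ((z - y : ℤ) : ℝ) ^ 2)⁻¹ := by
      intro z
      set t : ℝ := ((z - y : ℤ) : ℝ) ^ 2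
      have ht : 0 ≤ t := sq_nonneg _
      -- The two factors balance when `K z` is of order `s ^ 2` at distance `O(s ^ 2)`. The first is
      -- controlled by the degree and the second moment, the second by the Cauchy profile.
      have h3 : (K z : ℝ) = ((K z : ℝ) * (1 + (s ^ 4)⁻¹ * t) / s) *
          (s * (1 + (s ^ 4)⁻¹ * t)⁻¹) := by
        have : (1 + (s ^ 4)⁻¹ * t) ≠ 0 := by positivity
        field_simp
      calc √(K z : ℝ) = √(((K z : ℝ) * (1 + (s ^ 4)⁻¹ * t) / s) *
          (s * (1 + (s ^ 4)⁻¹ * t)⁻¹)) := by rw [← h3]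
        _ ≤ ((K z : ℝ) * (1 + (s ^ 4)⁻¹ * t) / s + s * (1 + (s ^ 4)⁻¹ * t)⁻¹) / 2 :=
          sqrt_mul_le_add_div_two (by positivity) (by positivity)
        _ = _ := by field_simp
    have h4 := sum_inv_one_add_mul_sq_le (a := (s ^ 4)⁻¹) (by positivity) y K.support
    have h5 : √((s ^ 4)⁻¹) = (s ^ 2)⁻¹ := by
      rw [Real.sqrt_inv, show s ^ 4 = (s ^ 2) ^ 2 by ring, Real.sqrt_sq (by positivity)]
    rw [h5, div_inv_eq_mul] at h4
    rw [Finsupp.sum, Finsupp.sum, Finsupp.degree_apply]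
    refine (Finset.sum_le_sum fun z _ => h2 z).trans ?_
    rw [Finset.sum_add_distrib, Finset.sum_add_distrib, ← Finset.mul_sum, ← Finset.mul_sum,
      ← Finset.mul_sum]
    rw [Nat.cast_sum]
    refine add_le_add le_rfl ?_
    have : s / 2 * (1 + 4 * s ^ 2) ≤ 5 / 2 * s ^ 3 := by nlinarith [sq_nonneg (s - 1)]
    exact (mul_le_mul_of_nonneg_left h4 (by positivity)).trans this
  have h6 : wordMean (SignType × SignType) m (fun ps => ((flips y ps).degree : ℝ)) ≤ s ^ 4 := by
    rw [← wordMean_const (α := SignType × SignType) m (s ^ 4)]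
    refine wordMean_mono fun ps hps => ?_
    rw [degree_flips, hsm]
    have : ps.countP (fun p => Flippable p) ≤ m := hps ▸ List.countP_le_length
    exact_mod_cast this.trans (Nat.le_succ m)
  have h7 := wordMean_sum_sq_mul_flips_le m y y
  simp only [sub_self, Int.cast_zero, ne_eq, OfNat.ofNat_ne_zero, not_false_eq_true, zero_pow,
    zero_add] at h7
  have h8 : (m : ℝ) * (2 * m) ≤ 2 * s ^ 8 := by
    have : s ^ 8 = (m + 1 : ℝ) ^ 2 := by rw [← hsm]; ring
    nlinarith [(Nat.cast_nonneg m : (0 : ℝ) ≤ m)]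
  refine (wordMean_mono fun ps _ => h1 (flips y ps)).trans ?_
  rw [wordMean_add, wordMean_add, wordMean_const, wordMean_const_mul, wordMean_const_mul]
  calc _ ≤ (2 * s)⁻¹ * s ^ 4 + (2 * s ^ 5)⁻¹ * (2 * s ^ 8) + 5 / 2 * s ^ 3 := by
        gcongr
        exact h7.trans h8
    _ = 4 * s ^ 3 := by field_simp; norm_num

/-- AM-GM at the typical local time `s ^ 2` reduces the power `3/2` to the powers `2` and `1`, whose
means are known. -/
theorem wordMean_sum_mul_sqrt_flips_le (m : ℕ) (y : ℤ) {s : ℝ} (hs : 0 < s)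
    (hsm : s ^ 4 = m + 1) :
    wordMean (SignType × SignType) m (fun ps => (flips y ps).sum fun _ k => (k : ℝ) * √(k : ℝ)) ≤
      7 * s ^ 5 := by
  have hs1 : 1 ≤ s := by
    by_contra! h
    have := pow_lt_one₀ hs.le h (n := 4) (by norm_num)
    linarith [(Nat.cast_nonneg m : (0 : ℝ) ≤ m)]
  have h1 : ∀ K : ℤ →₀ ℕ, (K.sum fun _ k => (k : ℝ) * √(k : ℝ)) ≤
      (2 * s)⁻¹ * (K.sum fun _ k => (k : ℝ) ^ 2) + s / 2 * K.degree := by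
    intro K
    have h2 : ∀ z, (K z : ℝ) * √(K z : ℝ) ≤ (2 * s)⁻¹ * (K z : ℝ) ^ 2 + s / 2 * (K z : ℝ) := by
      intro z
      have h3 : (K z : ℝ) = ((K z : ℝ) / s) * s := by field_simp
      have h4 : √(K z : ℝ) ≤ (K z / s + s) / 2 := by
        conv_lhs => rw [h3]
        exact sqrt_mul_le_add_div_two (by positivity) hs.le
      refine (mul_le_mul_of_nonneg_left h4 (Nat.cast_nonneg _)).trans (le_of_eq ?_)
      field_simp
    rw [Finsupp.sum, Finsupp.sum, Finsupp.degree_apply]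
    refine (Finset.sum_le_sum fun z _ => h2 z).trans (le_of_eq ?_)
    rw [Finset.sum_add_distrib, ← Finset.mul_sum, ← Finset.mul_sum]
    push_cast
    rfl
  have h6 : wordMean (SignType × SignType) m (fun ps => ((flips y ps).degree : ℝ)) ≤ s ^ 4 := by
    rw [← wordMean_const (α := SignType × SignType) m (s ^ 4)]
    refine wordMean_mono fun ps hps => ?_
    rw [degree_flips, hsm]
    have : ps.countP (fun p => Flippable p) ≤ m := hps ▸ List.countP_le_length
    exact_mod_cast this.trans (Nat.le_succ m)
  have h7 := wordMean_sum_sq_flips_le le_rfl y (m := m)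
  have h8 : √(m : ℝ) ≤ s ^ 2 := by
    rw [Real.sqrt_le_left (by positivity), ← pow_mul, hsm]
    linarith
  have h9 : (m : ℝ) * (1 + 12 * √m) ≤ s ^ 4 * (1 + 12 * s ^ 2) := by
    gcongr
    linarith
  refine (wordMean_mono fun ps _ => h1 (flips y ps)).trans ?_
  rw [wordMean_add, wordMean_const_mul, wordMean_const_mul]
  calc _ ≤ (2 * s)⁻¹ * (s ^ 4 * (1 + 12 * s ^ 2)) + s / 2 * s ^ 4 := by
        gcongr
        exact h7.trans h9
    _ = (s ^ 3 + 13 * s ^ 5) / 2 := by field_simp; ring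
    _ ≤ 7 * s ^ 5 := by nlinarith [pow_pos hs 3, pow_le_pow_right₀ hs1 (by norm_num : 3 ≤ 5)]

/-! ### A one-dimensional integral -/

theorem cos_le_exp_neg_sq {θ : ℝ} (h : |θ| ≤ Real.pi) : Real.cos θ ≤ Real.exp (-(θ ^ 2 / 5)) := by
  have h1 := Real.cos_le_one_sub_mul_cos_sq h
  have h2 := Real.add_one_le_exp (-(θ ^ 2 / 5))
  have h3 : 1 / 5 ≤ 2 / Real.pi ^ 2 := by
    rw [div_le_div_iff₀ (by norm_num) (by positivity)]
    nlinarith [Real.pi_lt_d2, Real.pi_pos]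
  nlinarith [sq_nonneg θ]

/-- The second factor is concentrated near the zeros `j * π / m` of `sin (m * θ)`. Only the zero
nearest to `θ` matters: there `|sin|` is at least `2 / π` times the distance, and the first factor
is dominated by a Cauchy profile in `j`. The other terms of the sum are nonnegative. -/
theorem exp_mul_exp_sin_le {B l : ℝ} (hB : 0 < B) (hl : 0 < l) {m : ℕ} (hm : 0 < m) {θ : ℝ}
    (hθ : |θ| ≤ Real.pi / 2) :
    Real.exp (-(B * (θ ^ 2 / 5))) * Real.exp (-(l * Real.sin (m * θ) ^ 2)) ≤
      ∑ j ∈ Finset.Icc (-(m : ℤ)) m, (1 + B / (4 * m ^ 2) * (j : ℝ) ^ 2)⁻¹ *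
        Real.exp (-(4 * l * m ^ 2 / Real.pi ^ 2) * (θ - j * Real.pi / m) ^ 2) := by
  have hpi := Real.pi_pos
  have hm' : (0 : ℝ) < m := by exact_mod_cast hm
  have hm1 : (1 : ℝ) ≤ m := by exact_mod_cast hm
  set x : ℝ := m * θ / Real.pi with hx
  have hθx : θ = x * Real.pi / m := by rw [hx]; field_simp
  set j : ℤ := round x with hj
  have hxj : |x - j| ≤ 1 / 2 := abs_sub_round x
  have hxm : |x| ≤ m / 2 := by
    rw [hx, abs_div, abs_mul, abs_of_pos hm', abs_of_pos hpi, div_le_iff₀ hpi]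
    calc (m : ℝ) * |θ| ≤ m * (Real.pi / 2) := by gcongr
      _ = m / 2 * Real.pi := by ring
  have hjm : j ∈ Finset.Icc (-(m : ℤ)) m := by
    have h1 : |(j : ℝ)| ≤ m := by
      have := abs_sub_abs_le_abs_sub (j : ℝ) x
      rw [abs_sub_comm] at this
      linarith
    rw [Finset.mem_Icc]
    have := abs_le.1 h1
    exact ⟨by exact_mod_cast this.1, by exact_mod_cast this.2⟩
  -- For `j ≠ 0`, `|x| ≥ |j| - 1/2 ≥ |j| / 2`; this is the source of the `4` in `B / (4 * m ^ 2)`.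
  have hjx : |(j : ℝ)| / 2 ≤ |x| := by
    by_cases h0 : j = 0
    · rw [h0]; simp
    · have h1 : (1 : ℝ) ≤ |(j : ℝ)| := by exact_mod_cast Int.one_le_abs h0
      have := abs_sub_abs_le_abs_sub (j : ℝ) x
      rw [abs_sub_comm] at this
      linarith
  have hfirst : Real.exp (-(B * (θ ^ 2 / 5))) ≤ (1 + B / (4 * m ^ 2) * (j : ℝ) ^ 2)⁻¹ := by
    rw [Real.exp_neg]
    gcongr
    refine le_trans ?_ (Real.add_one_le_exp _)
    rw [add_comm]
    refine add_le_add ?_ le_rfl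
    have h1 : (j : ℝ) ^ 2 ≤ 4 * x ^ 2 := by
      have : (|(j : ℝ)| / 2) ^ 2 ≤ |x| ^ 2 := by gcongr
      rw [div_pow, sq_abs, sq_abs] at this
      linarith
    rw [hθx, div_mul_eq_mul_div, mul_div_assoc]
    refine mul_le_mul_of_nonneg_left ?_ hB.le
    rw [div_pow, mul_pow, div_div, div_le_div_iff₀ (by positivity) (by positivity)]
    have h2 : 9 ≤ Real.pi ^ 2 := by nlinarith [Real.pi_gt_three]
    have h3 : 9 * x ^ 2 ≤ Real.pi ^ 2 * x ^ 2 := by gcongr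
    have h4 : 0 ≤ (m : ℝ) ^ 2 := by positivity
    nlinarith [sq_nonneg x]
  have hsecond : Real.exp (-(l * Real.sin (m * θ) ^ 2)) ≤
      Real.exp (-(4 * l * m ^ 2 / Real.pi ^ 2) * (θ - j * Real.pi / m) ^ 2) := by
    refine Real.exp_le_exp.2 ?_
    rw [neg_mul, neg_le_neg_iff]
    have h1 : Real.sin (m * θ) ^ 2 = Real.sin (m * θ - j * Real.pi) ^ 2 := by
      rw [Real.sin_sub_int_mul_pi, mul_pow, ← sq_abs ((-1 : ℝ) ^ j), abs_neg_one_zpow, one_pow,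
        one_mul]
    have h2 : (m : ℝ) * θ - j * Real.pi = (x - j) * Real.pi := by rw [hθx]; field_simp
    have h3 : |(m : ℝ) * θ - j * Real.pi| ≤ Real.pi / 2 := by
      rw [h2, abs_mul, abs_of_pos hpi]
      nlinarith
    have h4 := Real.mul_abs_le_abs_sin h3
    have h5 : (2 / Real.pi * |(m : ℝ) * θ - j * Real.pi|) ^ 2 ≤
        |Real.sin (m * θ - j * Real.pi)| ^ 2 := by gcongr
    rw [mul_pow, sq_abs, sq_abs] at h5
    rw [h1]
    calc 4 * l * m ^ 2 / Real.pi ^ 2 * (θ - j * Real.pi / m) ^ 2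
        = l * ((2 / Real.pi) ^ 2 * ((m : ℝ) * θ - j * Real.pi) ^ 2) := by field_simp; ring
      _ ≤ _ := by gcongr
  refine le_trans (mul_le_mul hfirst hsecond (Real.exp_pos _).le (by positivity)) ?_
  exact Finset.single_le_sum (f := fun j : ℤ => (1 + B / (4 * m ^ 2) * (j : ℝ) ^ 2)⁻¹ *
    Real.exp (-(4 * l * m ^ 2 / Real.pi ^ 2) * (θ - j * Real.pi / m) ^ 2))
    (fun _ _ => by positivity) hjm

/-- Each zero carries a Gaussian of mass at most `3 / (√l * m)`, and the effective number of zeros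
is at most `1 + 8 * m / √B`. -/
theorem integral_exp_mul_exp_sin_le {B l : ℝ} (hB : 0 < B) (hl : 0 < l) {m : ℕ} (hm : 0 < m) :
    ∫ θ in (-(Real.pi / 2))..(Real.pi / 2),
      Real.exp (-(B * (θ ^ 2 / 5))) * Real.exp (-(l * Real.sin (m * θ) ^ 2)) ≤
      24 / √l * (1 / m + 1 / √B) := by
  have hpi := Real.pi_pos
  have hm' : (0 : ℝ) < m := by exact_mod_cast hm
  have hle : -(Real.pi / 2) ≤ Real.pi / 2 := by linarith
  set b : ℝ := 4 * l * m ^ 2 / Real.pi ^ 2 with hb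
  have hb0 : 0 < b := by positivity
  have hint : ∀ j : ℤ, Integrable fun θ : ℝ =>
      Real.exp (-b * (θ - j * Real.pi / m) ^ 2) := fun j =>
    (integrable_exp_neg_mul_sq hb0).comp_sub_right (j * Real.pi / m)
  have hgauss : ∀ j : ℤ, ∫ θ in (-(Real.pi / 2))..(Real.pi / 2),
      Real.exp (-b * (θ - j * Real.pi / m) ^ 2) ≤ 3 / (√l * m) := by
    intro j
    rw [intervalIntegral.integral_of_le hle]
    refine (setIntegral_le_integral (hint j)
      (Filter.Eventually.of_forall fun θ => (Real.exp_pos _).le)).trans ?_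
    rw [integral_sub_right_eq_self (fun θ : ℝ => Real.exp (-b * θ ^ 2)), integral_gaussian,
      Real.sqrt_le_left (by positivity), div_pow, mul_pow, Real.sq_sqrt hl.le, hb, div_div_eq_mul_div,
      div_le_div_iff₀ (by positivity) (by positivity)]
    have h1 : Real.pi * Real.pi ^ 2 ≤ 36 := by
      have : Real.pi ^ 3 ≤ 3.15 ^ 3 := by gcongr; exact Real.pi_lt_d2.le
      nlinarith
    have h2 : 0 ≤ l * (m : ℝ) ^ 2 := by positivity
    nlinarith
  calc ∫ θ in (-(Real.pi / 2))..(Real.pi / 2),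
        Real.exp (-(B * (θ ^ 2 / 5))) * Real.exp (-(l * Real.sin (m * θ) ^ 2))
      ≤ ∫ θ in (-(Real.pi / 2))..(Real.pi / 2), ∑ j ∈ Finset.Icc (-(m : ℤ)) m,
          (1 + B / (4 * m ^ 2) * (j : ℝ) ^ 2)⁻¹ *
            Real.exp (-b * (θ - j * Real.pi / m) ^ 2) := by
        refine intervalIntegral.integral_mono_on hle
          (Continuous.intervalIntegrable (by fun_prop) _ _)
          (Continuous.intervalIntegrable (by fun_prop) _ _) fun θ hθ => ?_
        exact exp_mul_exp_sin_le hB hl hm (abs_le.2 hθ)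
    _ = ∑ j ∈ Finset.Icc (-(m : ℤ)) m, (1 + B / (4 * m ^ 2) * (j : ℝ) ^ 2)⁻¹ *
          ∫ θ in (-(Real.pi / 2))..(Real.pi / 2),
            Real.exp (-b * (θ - j * Real.pi / m) ^ 2) := by
        rw [intervalIntegral.integral_finsetSum fun j _ =>
          Continuous.intervalIntegrable (by fun_prop) _ _]
        simp only [intervalIntegral.integral_const_mul]
    _ ≤ ∑ j ∈ Finset.Icc (-(m : ℤ)) m, (1 + B / (4 * m ^ 2) * (j : ℝ) ^ 2)⁻¹ *
          (3 / (√l * m)) := by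
        gcongr with j
        exact hgauss j
    _ = (∑ j ∈ Finset.Icc (-(m : ℤ)) m, (1 + B / (4 * m ^ 2) * ((j - 0 : ℤ) : ℝ) ^ 2)⁻¹) *
          (3 / (√l * m)) := by
        rw [Finset.sum_mul]
        simp only [sub_zero]
    _ ≤ (1 + 4 / √(B / (4 * m ^ 2))) * (3 / (√l * m)) := by
        gcongr
        exact sum_inv_one_add_mul_sq_le (by positivity) 0 _
    _ ≤ 24 / √l * (1 / m + 1 / √B) := by
        have h1 : √(B / (4 * m ^ 2)) = √B / (2 * m) := by
          rw [Real.sqrt_div hB.le, show (4 : ℝ) * m ^ 2 = (2 * m) ^ 2 by ring,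
            Real.sqrt_sq (by positivity)]
        have hsB : 0 < √B := Real.sqrt_pos.2 hB
        have hsl : 0 < √l := Real.sqrt_pos.2 hl
        rw [h1]
        have h2 : 24 / √l * (1 / m + 1 / √B) - (1 + 4 / (√B / (2 * m))) * (3 / (√l * m)) =
            21 / (√l * m) := by
          field_simp
          ring
        have h3 : 0 ≤ 21 / (√l * m) := by positivity
        linarith

/-! ### Characteristic function of the drift under a product law -/

instance : MeasurableSingletonClass ℤˣ where
  measurableSet_singleton u := by
    refine ⟨{(u : ℤ)}, measurableSet_singleton _, ?_⟩
    ext v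
    simp [Units.ext_iff]

section Quenched

variable (p : ℤ → I)

/-- The product over `y ∈ ℤ` of the laws on `{1, -1}` that give mass `p y` to `1`. -/
abbrev productLaw : Measure Orientation := Measure.infinitePi fun y => signLaw (p y)

theorem measurable_drift (M : ℤ →₀ ℕ) : Measurable fun ε : Orientation => drift ε M := by
  unfold drift Finsupp.sum
  refine Finset.measurable_fun_sum _ fun z _ => ?_
  exact (Measurable.of_discrete (f := fun u : ℤˣ => (M z : ℤ) * (u : ℤ))).comp (measurable_pi_apply z)

open Complex in
theorem integral_signLaw (q : I) (g : ℤˣ → ℂ) :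
    ∫ u, g u ∂(signLaw q) = (q : ℝ) * g 1 + (1 - (q : ℝ)) * g (-1) := by
  have h1 : (0 : ℝ) ≤ 1 - q := by linarith [q.2.2]
  rw [signLaw, integral_add_measure, integral_smul_measure, integral_smul_measure,
    integral_dirac, integral_dirac, ENNReal.toReal_ofReal q.2.1, ENNReal.toReal_ofReal h1]
  · simp [Complex.real_smul]
  · exact (integrable_dirac (by simp)).smul_measure ENNReal.ofReal_ne_top
  · exact (integrable_dirac (by simp)).smul_measure ENNReal.ofReal_ne_top

open Complex in
theorem integral_cexp_drift (θ : ℝ) (M : ℤ →₀ ℕ) :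
    ∫ ε, cexp (θ * (drift ε M : ℂ) * Complex.I) ∂(productLaw p) =
      ∏ z ∈ M.support, ((p z : ℝ) * cexp (θ * M z * Complex.I) +
        (1 - (p z : ℝ)) * cexp (-(θ * M z * Complex.I))) := by
  have h1 : ∀ ε : Orientation, cexp (θ * (drift ε M : ℂ) * Complex.I) =
      ∏ z : M.support, cexp (θ * ((M z * (ε z : ℤ) : ℤ) : ℂ) * Complex.I) := by
    intro ε
    rw [Finset.prod_coe_sort M.support
      (fun z => cexp (θ * ((M z * (ε z : ℤ) : ℤ) : ℂ) * Complex.I)), ← Complex.exp_sum, drift,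
      Finsupp.sum]
    congr 1
    push_cast
    rw [Finset.mul_sum, Finset.sum_mul]
  simp only [h1]
  have hind : iIndepFun (fun (z : M.support) (ε : Orientation) => ε z) (productLaw p) :=
    (iIndepFun_infinitePi (P := fun y => signLaw (p y)) (X := fun _ u => u)
      (fun _ => measurable_id)).precomp Subtype.val_injective
  rw [hind.integral_fun_prod_comp (f := fun (z : M.support) (u : ℤˣ) =>
      cexp (θ * ((M z * (u : ℤ) : ℤ) : ℂ) * Complex.I))
      (fun z => (measurable_pi_apply _).aemeasurable)
      (fun z => Measurable.of_discrete.aestronglyMeasurable),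
    ← Finset.prod_coe_sort M.support]
  refine Finset.prod_congr rfl fun z _ => ?_
  have h2 := integral_map (μ := productLaw p) (φ := fun ε : Orientation => ε z)
    (measurable_pi_apply _).aemeasurable (f := fun u : ℤˣ =>
      cexp (θ * ((M z * (u : ℤ) : ℤ) : ℂ) * Complex.I)) Measurable.of_discrete.aestronglyMeasurable
  rw [← h2, productLaw, Measure.infinitePi_map_eval, integral_signLaw]
  simp

-- The sum is `cos a + i (2q - 1) sin a`, of squared modulus `1 - 4 q (1 - q) sin² a`; then `1 - x ≤
-- exp (-x)`.
open Complex in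
theorem norm_sign_char_le (q : I) (a : ℝ) :
    ‖((q : ℝ) : ℂ) * cexp (a * Complex.I) + (1 - (q : ℝ)) * cexp (-(a * Complex.I))‖ ≤
      Real.exp (-(2 * ((q : ℝ) * (1 - q)) * Real.sin a ^ 2)) := by
  have h1 : ((q : ℝ) : ℂ) * cexp (a * Complex.I) + (1 - (q : ℝ)) * cexp (-(a * Complex.I)) =
      (Real.cos a : ℝ) + ((2 * (q : ℝ) - 1) * Real.sin a : ℝ) * Complex.I := by
    rw [← neg_mul, Complex.exp_mul_I, Complex.exp_mul_I, Complex.cos_neg, Complex.sin_neg]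
    push_cast
    ring
  rw [h1, Complex.norm_add_mul_I, Real.sqrt_le_left (Real.exp_pos _).le, ← Real.exp_nat_mul]
  refine le_trans (le_of_eq ?_) (Real.add_one_le_exp _)
  have := Real.sin_sq_add_cos_sq a
  push_cast
  linear_combination this

theorem norm_integral_cexp_drift_le (θ : ℝ) {K M : ℤ →₀ ℕ} (hKM : K ≤ M) :
    ‖∫ ε, Complex.exp (θ * (drift ε M : ℂ) * Complex.I) ∂(productLaw p)‖ ≤
      Real.exp (-∑ z ∈ K.support, 2 * ((p z : ℝ) * (1 - p z)) * Real.sin (M z * θ) ^ 2) := by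
  rw [integral_cexp_drift, norm_prod, ← Finset.sum_neg_distrib, Real.exp_sum]
  have hsub : K.support ⊆ M.support := Finsupp.support_mono hKM
  have hle : ∀ z, ‖((p z : ℝ) : ℂ) * Complex.exp (θ * M z * Complex.I) +
      (1 - (p z : ℝ)) * Complex.exp (-(θ * M z * Complex.I))‖ ≤
      Real.exp (-(2 * ((p z : ℝ) * (1 - p z)) * Real.sin (M z * θ) ^ 2)) := by
    intro z
    have := norm_sign_char_le (p z) (θ * M z)
    rw [mul_comm (M z : ℝ)]
    simpa only [Complex.ofReal_mul, Complex.ofReal_natCast] using this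
  refine (Finset.prod_le_prod (fun _ _ => norm_nonneg _) fun z _ => hle z).trans ?_
  refine Finset.prod_le_prod_of_subset_of_le_one hsub (fun _ _ => (Real.exp_pos _).le)
    fun z _ _ => Real.exp_le_one_iff.2 ?_
  have : 0 ≤ (p z : ℝ) * (1 - p z) := mul_nonneg (p z).2.1 (by linarith [(p z).2.2])
  have : 0 ≤ 2 * ((p z : ℝ) * (1 - p z)) * Real.sin (M z * θ) ^ 2 := by positivity
  linarith

end Quenched

/-! ### The probability of a null drift after resampling -/

section Quenched

variable (p : ℤ → I)

theorem measurableSet_drift_eq_zero (M : ℤ →₀ ℕ) :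
    MeasurableSet {ε : Orientation | drift ε M = 0} :=
  measurable_drift M (measurableSet_singleton 0)

open Complex in
theorem measurable_cexp_drift (M : ℤ →₀ ℕ) :
    Measurable fun x : Orientation × ℝ => cexp (x.2 * (drift x.1 M : ℂ) * Complex.I) := by
  have h1 : Measurable fun x : Orientation × ℝ => (drift x.1 M : ℂ) :=
    (Measurable.of_discrete (f := fun k : ℤ => (k : ℂ))).comp
      ((measurable_drift M).comp measurable_fst)
  have h2 : Measurable fun x : Orientation × ℝ => (x.2 : ℂ) :=
    Complex.measurable_ofReal.comp measurable_snd
  exact Complex.measurable_exp.comp ((h2.mul h1).mul_const _)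

theorem norm_cexp_mul_intCast_mul_I (θ : ℝ) (k : ℤ) :
    ‖Complex.exp (θ * (k : ℂ) * Complex.I)‖ = 1 := by
  have : (θ * (k : ℂ) * Complex.I) = ((θ * k : ℝ) : ℂ) * Complex.I := by push_cast; ring
  rw [this, Complex.norm_exp_ofReal_mul_I]

theorem integrable_cexp_drift (θ : ℝ) (M : ℤ →₀ ℕ) :
    Integrable (fun ε => Complex.exp (θ * (drift ε M : ℂ) * Complex.I)) (productLaw p) :=
  Integrable.of_bound
    ((measurable_cexp_drift M).comp (measurable_id.prodMk measurable_const)).aestronglyMeasurable 1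
    (Filter.Eventually.of_forall fun _ => (norm_cexp_mul_intCast_mul_I θ _).le)

theorem continuous_integral_cexp_drift (M : ℤ →₀ ℕ) :
    Continuous fun θ : ℝ =>
      ∫ ε, Complex.exp (θ * (drift ε M : ℂ) * Complex.I) ∂(productLaw p) := by
  simp only [integral_cexp_drift]
  fun_prop

open Complex in
theorem measureReal_drift_eq_zero (M : ℤ →₀ ℕ) :
    (((productLaw p).real {ε | drift ε M = 0} : ℝ) : ℂ) =
      (2 * Real.pi : ℂ)⁻¹ * ∫ θ in Set.Ioc (-Real.pi) Real.pi,
        ∫ ε, cexp (θ * (drift ε M : ℂ) * Complex.I) ∂(productLaw p) := by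
  have h1 : (((productLaw p).real {ε | drift ε M = 0} : ℝ) : ℂ) =
      ∫ ε, (if drift ε M = 0 then 1 else 0 : ℂ) ∂(productLaw p) := by
    have : (fun ε => (if drift ε M = 0 then 1 else 0 : ℂ)) =
        {ε | drift ε M = 0}.indicator fun _ => (1 : ℂ) := by
      ext ε
      simp [Set.indicator_apply]
    rw [this, integral_indicator_const _ (measurableSet_drift_eq_zero M)]
    simp
  rw [h1]
  simp only [indicator_eq_integral_cexp]
  rw [integral_const_mul]
  congr 1
  simp only [intervalIntegral.integral_of_le (by linarith [Real.pi_pos] : -Real.pi ≤ Real.pi)]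
  refine integral_integral_swap ?_
  refine Integrable.of_bound (measurable_cexp_drift M).aestronglyMeasurable 1
    (Filter.Eventually.of_forall fun x => (norm_cexp_mul_intCast_mul_I _ _).le)

open Complex in
theorem wordMean_measureReal_drift_eq_zero (y : ℤ) (ps : List (SignType × SignType))
    (w : List SignType) :
    ((wordMean Bool ps.length fun bs => (productLaw p).real
      {ε | drift ε (visits y (resample ps bs ++ w)) = 0} : ℝ) : ℂ) =
      (2 * Real.pi : ℂ)⁻¹ * ∫ θ in Set.Ioc (-Real.pi) Real.pi,
        (cos θ) ^ (flips y ps).degree * ∫ ε, cexp (θ *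
          (drift ε (meanVisits y ps + visits (y + pairRise ps) w) : ℂ) * Complex.I)
            ∂(productLaw p) := by
  have h := wordMean_map Complex.ofRealCLM.toLinearMap ps.length fun bs => (productLaw p).real
      {ε | drift ε (visits y (resample ps bs ++ w)) = 0}
  simp only [ContinuousLinearMap.coe_coe, Complex.ofRealCLM_apply] at h
  rw [h]
  simp only [measureReal_drift_eq_zero, wordMean_const_mul]
  congr 1
  rw [← integral_wordMean]
  · congr 1 with θ
    rw [← integral_wordMean fun bs => integrable_cexp_drift p θ _]
    simp only [wordMean_cexp_drift]
    rw [integral_const_mul]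
  · intro bs
    exact ((continuous_integral_cexp_drift p _).integrableOn_Icc).mono_set Set.Ioc_subset_Icc_self

theorem integral_two_pi_eq_of_periodic {g : ℝ → ℝ} (hg : Function.Periodic g Real.pi)
    (hc : Continuous g) :
    ∫ θ in (-Real.pi)..Real.pi, g θ = 2 * ∫ θ in (-(Real.pi / 2))..(Real.pi / 2), g θ := by
  have h1 := hg.intervalIntegral_add_eq (-Real.pi) (-(Real.pi / 2))
  have h2 := hg.intervalIntegral_add_eq 0 (-(Real.pi / 2))
  rw [neg_add_cancel] at h1
  rw [zero_add] at h2
  rw [show -(Real.pi / 2) + Real.pi = Real.pi / 2 by ring] at h1 h2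
  rw [← intervalIntegral.integral_add_adjacent_intervals (hc.intervalIntegrable _ _)
    (hc.intervalIntegrable 0 _), h1, h2]
  ring

/-- Jensen's inequality for `exp` with weights `K z / K.degree`. It separates the heights, so that
each later term involves the variance at one height only. -/
theorem exp_neg_sum_le {K : ℤ →₀ ℕ} (hK : 0 < K.degree) (a : ℤ → ℝ) :
    Real.exp (-∑ z ∈ K.support, a z) ≤ ∑ z ∈ K.support, (K z / K.degree : ℝ) *
      Real.exp (-(K.degree / K z * a z)) := by
  have hB : (0 : ℝ) < K.degree := by exact_mod_cast hK
  have h := convexOn_exp.map_sum_le (t := K.support) (w := fun z => (K z / K.degree : ℝ))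
    (p := fun z => -(K.degree / K z * a z)) (fun z _ => by positivity) (by
      rw [← Finset.sum_div, div_eq_one_iff_eq hB.ne', Finsupp.degree_apply]
      push_cast
      rfl) (fun _ _ => Set.mem_univ _)
  simp only [smul_eq_mul] at h
  refine le_trans (le_of_eq ?_) h
  rw [← Finset.sum_neg_distrib]
  congr 1
  refine Finset.sum_congr rfl fun z hz => ?_
  have : (K z : ℝ) ≠ 0 := by exact_mod_cast Finsupp.mem_support_iff.1 hz
  field_simp

/-- The gain due to the local times `K` of the flippable pairs, at a height where the variance of
the orientation is of order `1`. -/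
def spread (K : ℤ →₀ ℕ) (z : ℤ) : ℝ :=
  √(K z : ℝ) / (K.degree * √(K.degree : ℝ)) + K z * √(K z : ℝ) / (K.degree : ℝ) ^ 2

theorem wordMean_measureReal_drift_eq_zero_le (hp : ∀ z, 0 < (p z : ℝ) * (1 - p z)) (y : ℤ)
    (ps : List (SignType × SignType)) (w : List SignType) (hK : 0 < (flips y ps).degree) :
    wordMean Bool ps.length (fun bs => (productLaw p).real
      {ε | drift ε (visits y (resample ps bs ++ w)) = 0}) ≤
      ∑ z ∈ (flips y ps).support, 24 * spread (flips y ps) z * (√((p z : ℝ) * (1 - p z)))⁻¹ := by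
  set K := flips y ps
  set M := meanVisits y ps + visits (y + pairRise ps) w with hM
  have hKM : K ≤ M := (flips_le_meanVisits y ps).trans le_self_add
  have hpi := Real.pi_pos
  have hB : (0 : ℝ) < K.degree := by exact_mod_cast hK
  let q : ℤ → ℝ := fun z => (p z : ℝ) * (1 - p z)
  let g : ℝ → ℝ := fun θ => |Real.cos θ| ^ K.degree *
    Real.exp (-∑ z ∈ K.support, 2 * q z * Real.sin (M z * θ) ^ 2)
  have hgc : Continuous g := by fun_prop
  have hgp : Function.Periodic g Real.pi := by
    intro θ
    simp only [g, Real.cos_add_pi, abs_neg]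
    congr 3
    refine Finset.sum_congr rfl fun z _ => ?_
    rw [mul_add, show (M z : ℝ) * Real.pi = ((M z : ℕ) : ℝ) * Real.pi by rfl,
      Real.sin_add_nat_mul_pi, mul_pow, ← pow_mul, mul_comm (M z) 2, pow_mul]
    simp
  have h1 : wordMean Bool ps.length (fun bs => (productLaw p).real
      {ε | drift ε (visits y (resample ps bs ++ w)) = 0}) ≤
      (2 * Real.pi)⁻¹ * ∫ θ in (-Real.pi)..Real.pi, g θ := by
    refine (le_abs_self _).trans ?_
    rw [← Real.norm_eq_abs, ← Complex.norm_real, wordMean_measureReal_drift_eq_zero, norm_mul]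
    have : ‖(2 * Real.pi : ℂ)⁻¹‖ = (2 * Real.pi)⁻¹ := by
      rw [norm_inv, norm_mul, Complex.norm_real, Real.norm_of_nonneg hpi.le]
      simp
    rw [this, ← intervalIntegral.integral_of_le (by linarith)]
    gcongr
    refine intervalIntegral.norm_integral_le_of_norm_le (by linarith) ?_
      (hgc.intervalIntegrable _ _)
    refine Filter.Eventually.of_forall fun θ _ => ?_
    rw [norm_mul, norm_pow, ← Complex.ofReal_cos, Complex.norm_real, Real.norm_eq_abs]
    exact mul_le_mul_of_nonneg_left (norm_integral_cexp_drift_le p θ hKM) (by positivity)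
  -- `|cos θ|` returns to `1` at `θ = ±π`, so Gaussian decay in `θ` is available only on the half
  -- period, where moreover `cos` is nonnegative.
  rw [integral_two_pi_eq_of_periodic hgp hgc] at h1
  let l : ℤ → ℝ := fun z => K.degree / K z * (2 * q z)
  have hl : ∀ z ∈ K.support, 0 < l z := by
    intro z hz
    have h2 : (0 : ℝ) < K z := by
      exact_mod_cast Nat.pos_of_ne_zero (Finsupp.mem_support_iff.1 hz)
    have := hp z
    positivity
  have h2 : ∫ θ in (-(Real.pi / 2))..(Real.pi / 2), g θ ≤
      ∑ z ∈ K.support, (K z / K.degree : ℝ) * (24 / √(l z) * (1 / M z + 1 / √(K.degree : ℝ))) := by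
    calc ∫ θ in (-(Real.pi / 2))..(Real.pi / 2), g θ
        ≤ ∫ θ in (-(Real.pi / 2))..(Real.pi / 2), ∑ z ∈ K.support, (K z / K.degree : ℝ) *
            (Real.exp (-(K.degree * (θ ^ 2 / 5))) *
              Real.exp (-(l z * Real.sin (M z * θ) ^ 2))) := by
          refine intervalIntegral.integral_mono_on (by linarith)
            (hgc.intervalIntegrable _ _)
            (Continuous.intervalIntegrable (by fun_prop) _ _) fun θ hθ => ?_
          have hc : 0 ≤ Real.cos θ := Real.cos_nonneg_of_mem_Icc hθ
          have hθ' : |θ| ≤ Real.pi := abs_le.2 ⟨by linarith [hθ.1], by linarith [hθ.2]⟩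
          have hfirst : |Real.cos θ| ^ K.degree ≤ Real.exp (-(K.degree * (θ ^ 2 / 5))) := by
            rw [abs_of_nonneg hc, ← mul_neg, Real.exp_nat_mul]
            exact pow_le_pow_left₀ hc (cos_le_exp_neg_sq hθ') _
          have hsecond := exp_neg_sum_le hK fun z => 2 * q z * Real.sin (M z * θ) ^ 2
          refine (mul_le_mul hfirst hsecond (Real.exp_pos _).le (Real.exp_pos _).le).trans
            (le_of_eq ?_)
          rw [Finset.mul_sum]
          refine Finset.sum_congr rfl fun z _ => ?_
          simp only [l]
          rw [mul_left_comm]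
          congr 4
          ring
      _ = ∑ z ∈ K.support, (K z / K.degree : ℝ) * ∫ θ in (-(Real.pi / 2))..(Real.pi / 2),
            (Real.exp (-(K.degree * (θ ^ 2 / 5))) *
              Real.exp (-(l z * Real.sin (M z * θ) ^ 2))) := by
          rw [intervalIntegral.integral_finsetSum fun j _ =>
            Continuous.intervalIntegrable (by fun_prop) _ _]
          simp only [intervalIntegral.integral_const_mul]
      _ ≤ _ := by
          refine Finset.sum_le_sum fun z hz => ?_
          gcongr
          refine integral_exp_mul_exp_sin_le hB (hl z hz) ?_
          exact lt_of_lt_of_le (Nat.pos_of_ne_zero (Finsupp.mem_support_iff.1 hz)) (hKM z)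
  have h3 : ∀ z ∈ K.support, (K z / K.degree : ℝ) *
      (24 / √(l z) * (1 / M z + 1 / √(K.degree : ℝ))) ≤ 24 * spread K z * (√(q z))⁻¹ := by
    intro z hz
    have hk : (0 : ℝ) < K z := by
      exact_mod_cast Nat.pos_of_ne_zero (Finsupp.mem_support_iff.1 hz)
    have hkM : (K z : ℝ) ≤ M z := by exact_mod_cast hKM z
    have hq : 0 < q z := hp z
    -- The factor `2` is dropped here, and below `M z` is replaced by the smaller `K z`, so the
    -- final bound depends on the local times `K` alone and not on the tail `w`.
    have h4 : K.degree / K z * q z ≤ l z := by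
      simp only [l]
      gcongr
      linarith
    have hsk : 0 < √(K z : ℝ) := Real.sqrt_pos.2 hk
    have hsq : 0 < √(q z) := Real.sqrt_pos.2 hq
    have hsB : 0 < √(K.degree : ℝ) := Real.sqrt_pos.2 hB
    calc (K z / K.degree : ℝ) * (24 / √(l z) * (1 / M z + 1 / √(K.degree : ℝ)))
        ≤ (K z / K.degree : ℝ) * (24 / √(K.degree / K z * q z) *
            (1 / K z + 1 / √(K.degree : ℝ))) := by gcongr
      _ = 24 * spread K z * (√(q z))⁻¹ := by
        rw [Real.sqrt_mul (by positivity), Real.sqrt_div hB.le, spread]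
        have e1 : (K z : ℝ) = √(K z : ℝ) ^ 2 := (Real.sq_sqrt hk.le).symm
        have e2 : (K.degree : ℝ) = √(K.degree : ℝ) ^ 2 := (Real.sq_sqrt hB.le).symm
        set a := √(K z : ℝ)
        set b := √(K.degree : ℝ)
        rw [e1, e2]
        field_simp
  have h5 : 0 ≤ ∫ θ in (-(Real.pi / 2))..(Real.pi / 2), g θ :=
    intervalIntegral.integral_nonneg (by linarith) fun θ _ => by positivity
  calc _ ≤ (2 * Real.pi)⁻¹ * (2 * ∫ θ in (-(Real.pi / 2))..(Real.pi / 2), g θ) := h1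
    _ = Real.pi⁻¹ * ∫ θ in (-(Real.pi / 2))..(Real.pi / 2), g θ := by field_simp
    _ ≤ 1 * ∫ θ in (-(Real.pi / 2))..(Real.pi / 2), g θ := by
      gcongr
      exact inv_le_one_of_one_le₀ (by linarith [Real.pi_gt_three])
    _ ≤ _ := by
      rw [one_mul]
      exact h2.trans (Finset.sum_le_sum h3)

end Quenched

/-! ### The annealed return probability -/

section Annealed

variable {E : Type*} [MeasurableSpace E] {μ : Measure E}
  {T : E ≃ᵐ E} {f : E → I}

theorem measurePreserving_zpow (hT : MeasurePreserving T μ μ) (z : ℤ) :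
    MeasurePreserving (fun x => ((T.toEquiv : Equiv.Perm E) ^ z) x) μ μ := by
  cases z with
  | ofNat n =>
    have : (fun x => ((T.toEquiv : Equiv.Perm E) ^ (Int.ofNat n)) x) = T^[n] := by
      rw [Int.ofNat_eq_natCast, zpow_natCast, Equiv.Perm.coe_pow]; rfl
    rw [this]
    exact hT.iterate n
  | negSucc n =>
    have : (fun x => ((T.toEquiv : Equiv.Perm E) ^ (Int.negSucc n)) x) = T.symm^[n + 1] := by
      rw [zpow_negSucc, ← inv_pow, Equiv.Perm.coe_pow]; rfl
    rw [this]
    exact (hT.symm T).iterate _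

/-- The inverse of the standard deviation of a sign that equals `1` with probability `f x`, up to
a factor `2`. -/
def invDev (f : E → I) (x : E) : ℝ := (√((f x : ℝ) * (1 - f x)))⁻¹

omit [MeasurableSpace E] in
theorem invDev_nonneg (x : E) : 0 ≤ invDev f x := inv_nonneg.2 (Real.sqrt_nonneg _)

theorem integral_invDev_nonneg : 0 ≤ ∫ x, invDev f x ∂μ := integral_nonneg invDev_nonneg

theorem measurable_mul_one_sub (hf : Measurable f) :
    Measurable fun x => (f x : ℝ) * (1 - f x) :=
  (measurable_subtype_coe.comp hf).mul (measurable_const.sub (measurable_subtype_coe.comp hf))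

/-- Where `f * (1 - f) = 0`, `invDev` takes the default value `0` whereas the hypothesis has `⊤`.
Domination survives, and `ae_mul_one_sub_pos` shows that such points are negligible. -/
theorem integrable_invDev (hf : Measurable f)
    (hf_int : ∫⁻ x, (ENNReal.ofReal (Real.sqrt ((f x : ℝ) * (1 - (f x : ℝ)))))⁻¹ ∂μ < ⊤) :
    Integrable (invDev f) μ := by
  refine ⟨(measurable_mul_one_sub hf).sqrt.inv.aestronglyMeasurable, ?_⟩
  rw [hasFiniteIntegral_iff_ofReal
    (Filter.Eventually.of_forall invDev_nonneg)]
  refine lt_of_le_of_lt (lintegral_mono fun x => ?_) hf_int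
  rcases (Real.sqrt_nonneg ((f x : ℝ) * (1 - f x))).eq_or_lt with h | h
  · simp [invDev, ← h]
  · rw [invDev, ENNReal.ofReal_inv_of_pos h]

theorem ae_mul_one_sub_pos (hf : Measurable f)
    (hf_int : ∫⁻ x, (ENNReal.ofReal (Real.sqrt ((f x : ℝ) * (1 - (f x : ℝ)))))⁻¹ ∂μ < ⊤) :
    ∀ᵐ x ∂μ, 0 < (f x : ℝ) * (1 - f x) := by
  have hm : Measurable fun x =>
      (ENNReal.ofReal (Real.sqrt ((f x : ℝ) * (1 - (f x : ℝ)))))⁻¹ :=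
    (measurable_mul_one_sub hf).sqrt.ennreal_ofReal.inv
  filter_upwards [ae_lt_top hm hf_int.ne] with x hx
  rw [ENNReal.inv_lt_top, ENNReal.ofReal_pos, Real.sqrt_pos] at hx
  exact hx

theorem measureReal_annealedLaw (hf : Measurable f) {A : Set Orientation} (hA : MeasurableSet A) :
    (annealedLaw μ T f).real A = ∫ x, (quenchedLaw T f x).real A ∂μ := by
  rw [Measure.real, annealedLaw_apply μ T hf hA]
  refine (integral_toReal ?_ (Filter.Eventually.of_forall fun x => measure_lt_top _ _)).symm
  exact ((Measure.measurable_coe hA).comp (measurable_quenchedLaw T hf)).aemeasurable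

variable [IsProbabilityMeasure μ]

theorem integrable_measureReal_quenchedLaw (hf : Measurable f) {A : Set Orientation}
    (hA : MeasurableSet A) : Integrable (fun x => (quenchedLaw T f x).real A) μ := by
  refine Integrable.of_bound (C := 1) ?_ (Filter.Eventually.of_forall fun x => ?_)
  · exact ((Measure.measurable_coe hA).comp
      (measurable_quenchedLaw T hf)).ennreal_toReal.aestronglyMeasurable
  · rw [Real.norm_of_nonneg measureReal_nonneg]
    exact measureReal_le_one

theorem wordMean_annealed_le_one (hf : Measurable f) (m : ℕ) (M : List Bool → ℤ →₀ ℕ) :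
    wordMean Bool m (fun bs => (annealedLaw μ T f).real {ε | drift ε (M bs) = 0}) ≤ 1 := by
  rw [← wordMean_const (α := Bool) m (1 : ℝ)]
  refine wordMean_mono fun bs _ => ?_
  rw [measureReal_annealedLaw hf (measurableSet_drift_eq_zero _)]
  refine (integral_mono (integrable_measureReal_quenchedLaw hf (measurableSet_drift_eq_zero _))
    (integrable_const (1 : ℝ)) fun x => measureReal_le_one).trans ?_
  simp

/-- The quenched bound is a linear combination of the values of `invDev f` along the orbit of `x`,
with coefficients free of `x`. Invariance of `μ` gives them all the same integral. -/
theorem wordMean_annealed_le (hT : MeasurePreserving T μ μ) (hf : Measurable f)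
    (hf_int : ∫⁻ x, (ENNReal.ofReal (Real.sqrt ((f x : ℝ) * (1 - (f x : ℝ)))))⁻¹ ∂μ < ⊤)
    (y : ℤ) (ps : List (SignType × SignType)) (w : List SignType)
    (hK : 0 < (flips y ps).degree) :
    wordMean Bool ps.length (fun bs => (annealedLaw μ T f).real
      {ε | drift ε (visits y (resample ps bs ++ w)) = 0}) ≤
      24 * (∫ x, invDev f x ∂μ) * ∑ z ∈ (flips y ps).support, spread (flips y ps) z := by
  have hint : ∀ z : ℤ, Integrable
      (fun x => invDev f (((T.toEquiv : Equiv.Perm E) ^ z) x)) μ := fun z =>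
    ((measurePreserving_zpow hT z).integrable_comp
      (integrable_invDev hf hf_int).aestronglyMeasurable).2 (integrable_invDev hf hf_int)
  simp only [measureReal_annealedLaw hf (measurableSet_drift_eq_zero _)]
  rw [← integral_wordMean fun bs =>
    integrable_measureReal_quenchedLaw hf (measurableSet_drift_eq_zero _)]
  calc _ ≤ ∫ x, ∑ z ∈ (flips y ps).support, 24 * spread (flips y ps) z *
        invDev f (((T.toEquiv : Equiv.Perm E) ^ z) x) ∂μ := by
        refine integral_mono_ae (integrable_wordMean fun bs =>
          integrable_measureReal_quenchedLaw hf (measurableSet_drift_eq_zero _))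
          (integrable_finsetSum _ fun z _ => (hint z).const_mul _) ?_
        have hae : ∀ᵐ x ∂μ, ∀ z : ℤ, 0 < (f (((T.toEquiv : Equiv.Perm E) ^ z) x) : ℝ) *
            (1 - f (((T.toEquiv : Equiv.Perm E) ^ z) x)) :=
          ae_all_iff.2 fun z => (measurePreserving_zpow hT z).quasiMeasurePreserving.ae
            (ae_mul_one_sub_pos hf hf_int)
        filter_upwards [hae] with x hx
        exact wordMean_measureReal_drift_eq_zero_le
          (fun z => f (((T.toEquiv : Equiv.Perm E) ^ z) x)) hx y ps w hK
    _ = ∑ z ∈ (flips y ps).support, 24 * spread (flips y ps) z * ∫ x, invDev f x ∂μ := by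
        rw [integral_finsetSum _ fun z _ => (hint z).const_mul _]
        refine Finset.sum_congr rfl fun z _ => ?_
        rw [integral_const_mul]
        congr 1
        have hmp := measurePreserving_zpow hT z
        have h := integral_map (μ := μ) hmp.measurable.aemeasurable (f := invDev f)
          (by rw [hmp.map_eq]; exact (integrable_invDev hf hf_int).aestronglyMeasurable)
        rw [hmp.map_eq] at h
        exact h.symm
    _ = _ := by
        rw [Finset.mul_sum]
        exact Finset.sum_congr rfl fun z _ => by ring

theorem sum_spread_le {K : ℤ →₀ ℕ} {s : ℝ} (hs : 0 < s) (hK : s ^ 4 ≤ 10 * K.degree) :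
    ∑ z ∈ K.support, spread K z ≤ 32 / s ^ 6 * (K.sum fun _ k => √(k : ℝ)) +
      100 / s ^ 8 * (K.sum fun _ k => (k : ℝ) * √(k : ℝ)) := by
  have hB : s ^ 4 / 10 ≤ (K.degree : ℝ) := by linarith
  have hB0 : (0 : ℝ) < K.degree := lt_of_lt_of_le (by positivity) hB
  -- `10 / 32` is a rational lower bound for `1 / √10`.
  have hsB : 10 / 32 * s ^ 2 ≤ √(K.degree : ℝ) := by
    refine Real.le_sqrt_of_sq_le (le_trans ?_ hB)
    nlinarith [pow_pos hs 4]
  have h1 : s ^ 6 / 32 ≤ K.degree * √(K.degree : ℝ) := by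
    calc s ^ 6 / 32 = (s ^ 4 / 10) * (10 / 32 * s ^ 2) := by ring
      _ ≤ _ := by gcongr
  have h2 : s ^ 8 / 100 ≤ (K.degree : ℝ) ^ 2 := by
    calc s ^ 8 / 100 = (s ^ 4 / 10) ^ 2 := by ring
      _ ≤ _ := by gcongr
  rw [Finsupp.sum, Finsupp.sum, Finset.mul_sum, Finset.mul_sum, ← Finset.sum_add_distrib]
  refine Finset.sum_le_sum fun z _ => ?_
  rw [spread]
  gcongr ?_ + ?_
  · calc √(K z : ℝ) / (K.degree * √(K.degree : ℝ)) ≤ √(K z : ℝ) / (s ^ 6 / 32) := by gcongr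
      _ = _ := by field_simp
  · calc K z * √(K z : ℝ) / (K.degree : ℝ) ^ 2 ≤ K z * √(K z : ℝ) / (s ^ 8 / 100) := by gcongr
      _ = _ := by field_simp

/-- The bound `D` on the drift depends on the pairs alone, so it multiplies the probability that the
tail closes the height. Its mean is `O(s ^ (-3))`, the height costs `3 / s ^ 2`, and too few
flippable pairs cost only `O(s ^ (-4))`. -/
theorem wordMean_return_le (hT : MeasurePreserving T μ μ) (hf : Measurable f)
    (hf_int : ∫⁻ x, (ENNReal.ofReal (Real.sqrt ((f x : ℝ) * (1 - (f x : ℝ)))))⁻¹ ∂μ < ⊤)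
    (y : ℤ) (m n : ℕ) (hmn : m ≤ n) {s : ℝ} (hs : 0 < s) (hsm : s ^ 4 = m + 1) :
    wordMean SignType (2 * m + n) (fun w => if rise w = 0 then
      (annealedLaw μ T f).real {ε | drift ε (visits y w) = 0} else 0) ≤
      (81 + 59616 * ∫ x, invDev f x ∂μ) / s ^ 5 := by
  set c := ∫ x, invDev f x ∂μ with hc
  have hc0 : 0 ≤ c := integral_invDev_nonneg
  let D : List (SignType × SignType) → ℝ := fun ps =>
    (if 10 * (flips y ps).degree < m + 1 then (1 : ℝ) else 0) +
      24 * c * (32 / s ^ 6 * ((flips y ps).sum fun _ k => √(k : ℝ)) +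
        100 / s ^ 8 * ((flips y ps).sum fun _ k => (k : ℝ) * √(k : ℝ)))
  have hsum : ∀ ps, 0 ≤ 24 * c * (32 / s ^ 6 * ((flips y ps).sum fun _ k => √(k : ℝ)) +
        100 / s ^ 8 * ((flips y ps).sum fun _ k => (k : ℝ) * √(k : ℝ))) := by
    intro ps
    unfold Finsupp.sum
    positivity
  have hD0 : ∀ ps, 0 ≤ D ps := by
    intro ps
    exact add_nonneg (by split_ifs <;> norm_num) (hsum ps)
  have hD : ∀ ps : List (SignType × SignType), ps.length = m → ∀ w : List SignType,
      wordMean Bool m (fun bs => (annealedLaw μ T f).real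
        {ε | drift ε (visits y (resample ps bs ++ w)) = 0}) ≤ D ps := by
    intro ps hps w
    by_cases h : 10 * (flips y ps).degree < m + 1
    · simp only [D, if_pos h]
      linarith [wordMean_annealed_le_one (μ := μ) (T := T) hf m
        fun bs => visits y (resample ps bs ++ w), hsum ps]
    · simp only [D, if_neg h, zero_add]
      rw [← hps]
      refine (wordMean_annealed_le hT hf hf_int y ps w (by omega)).trans ?_
      gcongr
      refine sum_spread_le hs ?_
      rw [hsm]
      exact_mod_cast not_lt.1 h
  have hsplit : wordMean SignType (2 * m + n) (fun w => if rise w = 0 then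
      (annealedLaw μ T f).real {ε | drift ε (visits y w) = 0} else 0) ≤
      wordMean (SignType × SignType) m (fun ps => D ps * (3 / √(n + 1 : ℝ))) := by
    rw [wordMean_append, wordMean_two_mul]
    refine wordMean_mono fun ps hps => ?_
    -- The coins must be averaged with the tail fixed; the closing condition on the height can then
    -- be factored out, since it does not see the coins.
    rw [wordMean_comm]
    calc _ ≤ wordMean SignType n fun w => D ps * if rise w = -pairRise ps then 1 else 0 := by
          refine wordMean_mono fun w _ => ?_
          have h1 : wordMean Bool m (fun bs => if rise (resample ps bs ++ w) = 0 then
              (annealedLaw μ T f).real {ε | drift ε (visits y (resample ps bs ++ w)) = 0} else 0) =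
              wordMean Bool m (fun bs => if rise w = -pairRise ps then
              (annealedLaw μ T f).real {ε | drift ε (visits y (resample ps bs ++ w)) = 0}
                else 0) := by
            refine wordMean_congr fun bs hbs => ?_
            refine if_congr ?_ rfl rfl
            rw [rise_append, rise_resample _ _ (by omega)]
            omega
          rw [h1]
          split_ifs with h
          · rw [mul_one]
            exact hD ps hps w
          · rw [mul_zero, wordMean_const]
      _ ≤ D ps * (3 / √(n + 1 : ℝ)) := by
          rw [wordMean_const_mul]
          exact mul_le_mul_of_nonneg_left (wordMean_rise_eq_le n _) (hD0 ps)
  have hs1 : 1 ≤ s := by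
    by_contra! h
    have := pow_lt_one₀ hs.le h (n := 4) (by norm_num)
    linarith [(Nat.cast_nonneg m : (0 : ℝ) ≤ m)]
  have hmean : wordMean (SignType × SignType) m D ≤ (27 + 19872 * c) / s ^ 3 := by
    rw [wordMean_add, wordMean_const_mul, wordMean_add, wordMean_const_mul, wordMean_const_mul]
    calc _ ≤ 27 / ((m : ℝ) + 1) + 24 * c * (32 / s ^ 6 * (4 * s ^ 3) +
          100 / s ^ 8 * (7 * s ^ 5)) := by
          gcongr
          · exact wordMean_degree_flips_lt_le m y
          · exact wordMean_sum_sqrt_flips_le m y hs hsm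
          · exact wordMean_sum_mul_sqrt_flips_le m y hs hsm
      _ = 27 / s ^ 4 + 19872 * c / s ^ 3 := by
          rw [← hsm]; field_simp; ring
      _ ≤ 27 / s ^ 3 + 19872 * c / s ^ 3 := by
          gcongr ?_ + _
          exact div_le_div_of_nonneg_left (by norm_num) (by positivity)
            (pow_le_pow_right₀ hs1 (by norm_num))
      _ = _ := by ring
  have hn : s ^ 2 ≤ √(n + 1 : ℝ) := by
    refine Real.le_sqrt_of_sq_le ?_
    rw [← pow_mul, hsm]
    gcongr
  rw [wordMean_mul_const] at hsplit
  refine hsplit.trans ?_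
  calc _ ≤ (27 + 19872 * c) / s ^ 3 * (3 / s ^ 2) := by gcongr
    _ = (81 + 59616 * c) / s ^ 5 := by field_simp; ring

theorem summable_wordMean_return (hT : MeasurePreserving T μ μ) (hf : Measurable f)
    (hf_int : ∫⁻ x, (ENNReal.ofReal (Real.sqrt ((f x : ℝ) * (1 - (f x : ℝ)))))⁻¹ ∂μ < ⊤)
    (y : ℤ) :
    Summable fun N => wordMean SignType N (fun w => if rise w = 0 then
      (annealedLaw μ T f).real {ε | drift ε (visits y w) = 0} else 0) := by
  set C := 81 + 59616 * ∫ x, invDev f x ∂μ with hC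
  have hC0 : 0 ≤ C := by
    have := integral_invDev_nonneg (μ := μ) (f := f)
    positivity
  have hsum : Summable fun N : ℕ => C * ((1 / 4 : ℝ) ^ (-(5 / 4) : ℝ) *
      ((N + 1 : ℕ) : ℝ) ^ (-(5 / 4) : ℝ)) :=
    (((summable_nat_add_iff 1).2 (Real.summable_nat_rpow.2 (by norm_num :
      (-(5 / 4) : ℝ) < -1))).mul_left _).mul_left _
  refine Summable.of_nonneg_of_le (fun N => wordMean_nonneg fun w => ?_) (fun N => ?_) hsum
  · split_ifs
    · exact measureReal_nonneg
    · exact le_rfl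
  -- With this choice `n = N - 2 * m ≥ m`, and `N + 1 ≤ 4 * (m + 1)` turns `(m + 1) ^ (-5/4)` into a
  -- summable function of `N`.
  · set m := N / 4 with hm
    have hm0 : (0 : ℝ) < m + 1 := by positivity
    obtain ⟨n, hn⟩ : ∃ n, N = 2 * m + n := ⟨N - 2 * m, by omega⟩
    have h := wordMean_return_le hT hf hf_int y m n (by omega)
      (s := (m + 1 : ℝ) ^ (1 / 4 : ℝ)) (by positivity)
      (by rw [← Real.rpow_natCast, ← Real.rpow_mul hm0.le]; norm_num)
    rw [← hn] at h
    refine h.trans ?_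
    rw [div_eq_mul_inv, ← Real.rpow_natCast, ← Real.rpow_mul hm0.le, ← Real.rpow_neg hm0.le,
      ← Real.mul_rpow (by norm_num) (by positivity)]
    gcongr
    have h1 : (1 / 4 : ℝ) * ((N + 1 : ℕ) : ℝ) ≤ m + 1 := by
      have : N + 1 ≤ 4 * (m + 1) := by omega
      have : ((N + 1 : ℕ) : ℝ) ≤ 4 * (m + 1) := by exact_mod_cast this
      linarith
    refine le_trans (le_of_eq ?_) (Real.rpow_le_rpow_of_nonpos (by positivity) h1 (by norm_num))
    norm_num

end Annealed

/-! ### The simple random walk as a mean over words -/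

/-- The vertex reached from `u` along a word of moves. -/
def endpoint (ε : Orientation) (u : ℤ × ℤ) (w : List SignType) : ℤ × ℤ :=
  (u.1 + drift ε (visits u.2 w), u.2 + rise w)

theorem endpoint_append (ε : Orientation) (u : ℤ × ℤ) (v w : List SignType) :
    endpoint ε u (v ++ w) = endpoint ε (endpoint ε u v) w := by
  simp [endpoint, visits_append, add_assoc]

theorem lintegral_stepKernel (ε : Orientation) (u : ℤ × ℤ) (g : ℤ × ℤ → ℝ) (hg : ∀ v, 0 ≤ g v) :
    ∫⁻ v, ENNReal.ofReal (g v) ∂(stepKernel ε u) =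
      ENNReal.ofReal (wordMean SignType 1 fun w => g (endpoint ε u w)) := by
  change ∫⁻ v, ENNReal.ofReal (g v) ∂(stepPMF ε u).toMeasure = _
  rw [lintegral_countable']
  simp only [PMF.toMeasure_apply_singleton _ _ (measurableSet_singleton _)]
  rw [tsum_eq_sum (s := outNeighbors ε u)]
  · have h1 : ∀ v ∈ outNeighbors ε u, ENNReal.ofReal (g v) * stepPMF ε u v =
        ENNReal.ofReal (g v * (1 / 3)) := by
      intro v hv
      rw [mem_outNeighbors] at hv
      rw [ENNReal.ofReal_mul (hg v)]
      congr 1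
      change transProb ε u v = _
      rw [transProb, if_pos hv, ENNReal.ofReal_div_of_pos (by norm_num)]
      simp
    have h0 : ((ε u.2 : ℤˣ) : ℤ) ≠ 0 := Units.ne_zero _
    rw [Finset.sum_congr rfl h1, ← ENNReal.ofReal_sum_of_nonneg fun v _ => by
      have := hg v; positivity]
    congr 1
    rw [wordMean_succ, sum_signType, card_signType, outNeighbors, Finset.sum_insert,
      Finset.sum_insert, Finset.sum_singleton]
    · simp only [wordMean_zero, endpoint, visits, smul_eq_mul]
      simp [sub_eq_add_neg]
      ring
    · simp only [Finset.mem_singleton, Prod.ext_iff]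
      omega
    · simp only [Finset.mem_insert, Finset.mem_singleton, Prod.ext_iff]
      omega
  · intro v hv
    have : stepPMF ε u v = 0 := by
      rw [mem_outNeighbors] at hv
      change transProb ε u v = 0
      rw [transProb, if_neg hv]
    rw [this, mul_zero]

/-- Induction peels off the last letter by the Markov property; `g` is generalised because one step
replaces it by its mean over the next move. -/
theorem lintegral_walkLaw (ε : Orientation) (u : ℤ × ℤ) (n : ℕ) (g : ℤ × ℤ → ℝ)
    (hg : ∀ v, 0 ≤ g v) :
    ∫⁻ M, ENNReal.ofReal (g (M n)) ∂(walkLaw ε u) =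
      ENNReal.ofReal (wordMean SignType n fun w => g (endpoint ε u w)) := by
  induction n generalizing g with
  | zero =>
    have h1 : (walkLaw ε u).map (Preorder.frestrictLe 0) =
        (Measure.dirac u).map (MeasurableEquiv.piUnique (fun _ : Finset.Iic 0 => ℤ × ℤ)).symm := by
      rw [walkLaw, Kernel.trajMeasure, Measure.map_comp _ _ (by fun_prop),
        Kernel.traj_map_frestrictLe, Kernel.partialTraj_self, Measure.id_comp]
    have hm : Measurable fun x : (i : Finset.Iic 0) → ℤ × ℤ =>
        ENNReal.ofReal (g (x ⟨0, Finset.mem_Iic.2 le_rfl⟩)) :=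
      (measurable_of_countable (fun v : ℤ × ℤ => ENNReal.ofReal (g v))).comp
        (measurable_pi_apply _)
    have h2 := lintegral_map (μ := walkLaw ε u) hm
      (g := fun M : ℕ → ℤ × ℤ => Preorder.frestrictLe 0 M) (by fun_prop)
    rw [h1, lintegral_map hm (by fun_prop), lintegral_dirac] at h2
    simp only [Preorder.frestrictLe_apply] at h2
    rw [← h2]
    simp [wordMean_zero, endpoint, visits, MeasurableEquiv.piUnique]
  | succ n ih =>
    have hm : Measurable fun x : ((i : Finset.Iic n) → ℤ × ℤ) × (ℤ × ℤ) => ENNReal.ofReal (g x.2) :=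
      (measurable_of_countable (fun v : ℤ × ℤ => ENNReal.ofReal (g v))).comp measurable_snd
    have h := Kernel.map_frestrictLe_trajMeasure_compProd_eq_map_trajMeasure
      (X := fun _ => ℤ × ℤ) (μ₀ := Measure.dirac u) (a := n) (κ := fun n => (stepKernel ε).comap
        (fun h : (i : Finset.Iic n) → ℤ × ℤ => h ⟨n, Finset.mem_Iic.2 le_rfl⟩)
        (measurable_pi_apply _))
    have h1 := lintegral_map (μ := walkLaw ε u)
      (f := fun x : ((i : Finset.Iic n) → ℤ × ℤ) × (ℤ × ℤ) => ENNReal.ofReal (g x.2))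
      (g := fun x : ℕ → ℤ × ℤ => (Preorder.frestrictLe n x, x (n + 1)))
      hm (by fun_prop)
    rw [← h1, walkLaw, ← h, Measure.lintegral_compProd hm,
      lintegral_map (Measurable.lintegral_kernel_prod_right' hm) (by fun_prop)]
    simp only [Kernel.comap_apply, lintegral_stepKernel ε _ g hg, Preorder.frestrictLe_apply]
    rw [wordMean_append]
    simp only [endpoint_append]
    exact ih (fun v => wordMean SignType 1 fun w => g (endpoint ε v w))
      fun v => wordMean_nonneg fun w => hg _

theorem walkLaw_eq (ε : Orientation) (u v : ℤ × ℤ) (n : ℕ) :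
    walkLaw ε u {M | M n = v} =
      ENNReal.ofReal (wordMean SignType n fun w => if endpoint ε u w = v then 1 else 0) := by
  rw [← lintegral_walkLaw ε u n (fun x => if x = v then 1 else 0)
    fun x => by split_ifs <;> norm_num]
  have : (fun M : ℕ → ℤ × ℤ => ENNReal.ofReal (if M n = v then 1 else 0)) =
      {M : ℕ → ℤ × ℤ | M n = v}.indicator 1 := by
    ext M
    simp only [Set.indicator_apply, Set.mem_ofPred_eq, Pi.one_apply]
    split_ifs <;> simp
  have hm : MeasurableSet {M : ℕ → ℤ × ℤ | M n = v} :=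
    (measurable_pi_apply (X := fun _ : ℕ => ℤ × ℤ) n) (measurableSet_singleton v)
  rw [this, lintegral_indicator_one hm]

theorem endpoint_eq_self_iff (ε : Orientation) (u : ℤ × ℤ) (w : List SignType) :
    endpoint ε u w = u ↔ rise w = 0 ∧ drift ε (visits u.2 w) = 0 := by
  simp [endpoint, Prod.ext_iff, and_comm]

/-- The first Borel-Cantelli lemma. -/
theorem isTransient_of_tsum_ne_top {ε : Orientation}
    (h : ∀ u : ℤ × ℤ, ∑' n, walkLaw ε u {M | M n = u} ≠ ⊤) : IsTransient ε := by
  intro u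
  have := measure_setOfPred_frequently_eq_zero (μ := walkLaw ε u) (p := fun n M => M n = u) (h u)
  rw [ae_iff]
  simpa only [Nat.frequently_atTop_iff_infinite, Set.Infinite] using this

/-! ### Averaging over the orientation: annealed and quenched transience -/

section

variable {E : Type*} [MeasurableSpace E] {μ : Measure E} [IsProbabilityMeasure μ]
  {T : E ≃ᵐ E} {f : E → I}

theorem measurable_indicator_endpoint (u : ℤ × ℤ) (w : List SignType) :
    Measurable fun ε : Orientation => if endpoint ε u w = u then (1 : ℝ) else 0 := by
  simp only [endpoint_eq_self_iff]
  refine Measurable.ite ?_ measurable_const measurable_const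
  by_cases h : rise w = 0
  · simpa [h] using measurableSet_drift_eq_zero (visits u.2 w)
  · simp [h]

theorem measurable_walkLaw_return (u : ℤ × ℤ) (n : ℕ) :
    Measurable fun ε : Orientation => walkLaw ε u {M | M n = u} := by
  simp only [walkLaw_eq]
  exact (measurable_wordMean fun w => measurable_indicator_endpoint u w).ennreal_ofReal

theorem isProbabilityMeasure_annealedLaw (hf : Measurable f) :
    IsProbabilityMeasure (annealedLaw μ T f) :=
  ⟨by rw [annealedLaw_apply μ T hf MeasurableSet.univ]; simp⟩

theorem lintegral_walkLaw_return (hf : Measurable f) (u : ℤ × ℤ) (n : ℕ) :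
    ∫⁻ ε, walkLaw ε u {M | M n = u} ∂(annealedLaw μ T f) =
      ENNReal.ofReal (wordMean SignType n fun w => if rise w = 0 then
        (annealedLaw μ T f).real {ε | drift ε (visits u.2 w) = 0} else 0) := by
  have := isProbabilityMeasure_annealedLaw (μ := μ) (T := T) hf
  have hint : ∀ w, Integrable (fun ε : Orientation => if endpoint ε u w = u then (1 : ℝ) else 0)
      (annealedLaw μ T f) := fun w =>
    Integrable.of_bound (measurable_indicator_endpoint u w).aestronglyMeasurable 1
      (Filter.Eventually.of_forall fun ε => by split_ifs <;> simp)
  simp only [walkLaw_eq]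
  rw [← ofReal_integral_eq_lintegral_ofReal (integrable_wordMean hint)
    (Filter.Eventually.of_forall fun ε => wordMean_nonneg fun w => by split_ifs <;> simp),
    integral_wordMean hint]
  congr 1
  refine wordMean_congr fun w _ => ?_
  simp only [endpoint_eq_self_iff]
  split_ifs with h
  · have : (fun ε : Orientation => if rise w = 0 ∧ drift ε (visits u.2 w) = 0 then (1 : ℝ) else 0) =
        {ε : Orientation | drift ε (visits u.2 w) = 0}.indicator 1 := by
      ext ε
      simp [Set.indicator_apply, h]
    rw [this, integral_indicator_one (measurableSet_drift_eq_zero _)]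
  · simp [h]

/-- By Tonelli the annealed mean of the Green sum at `u` is the series of annealed return
probabilities. Its convergence makes the sum finite almost surely, simultaneously for the countably
many `u`. -/
theorem ae_annealedLaw_isTransient (hT : MeasurePreserving T μ μ) (hf : Measurable f)
    (hf_int : ∫⁻ x, (ENNReal.ofReal (Real.sqrt ((f x : ℝ) * (1 - (f x : ℝ)))))⁻¹ ∂μ < ⊤) :
    ∀ᵐ ε ∂(annealedLaw μ T f), IsTransient ε := by
  have h : ∀ᵐ ε ∂(annealedLaw μ T f), ∀ u : ℤ × ℤ, ∑' n, walkLaw ε u {M | M n = u} < ⊤ := by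
    refine ae_all_iff.2 fun u => ae_lt_top
      (Measurable.tsum fun n => measurable_walkLaw_return u n) ?_
    rw [lintegral_tsum fun n => (measurable_walkLaw_return u n).aemeasurable]
    simp only [lintegral_walkLaw_return hf]
    rw [← ENNReal.ofReal_tsum_of_nonneg _ (summable_wordMean_return hT hf hf_int u.2)]
    · exact ENNReal.ofReal_ne_top
    · exact fun n => wordMean_nonneg fun w => by
        split_ifs
        · exact measureReal_nonneg
        · exact le_rfl
  filter_upwards [h] with ε hε
  exact isTransient_of_tsum_ne_top fun u => (hε u).ne

omit [IsProbabilityMeasure μ] in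
theorem ae_ae_quenchedLaw_of_ae_annealedLaw (hf : Measurable f) {P : Orientation → Prop}
    (h : ∀ᵐ ε ∂(annealedLaw μ T f), P ε) : ∀ᵐ x ∂μ, ∀ᵐ ε ∂(quenchedLaw T f x), P ε := by
  -- The set where `P` fails need not be measurable, while the averaging formula requires a
  -- measurable set.
  obtain ⟨N, hN, hNm, hN0⟩ := exists_measurable_superset_of_null h
  rw [annealedLaw_apply μ T hf hNm, lintegral_eq_zero_iff
    (f := fun x => quenchedLaw T f x N)
    ((Measure.measurable_coe hNm).comp (measurable_quenchedLaw T hf))] at hN0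
  filter_upwards [hN0] with x hx
  exact measure_mono_null hN hx

end

end OrientedLattice

end

theorem theorem1 {E : Type*} [MeasurableSpace E] (μ : Measure E) [IsProbabilityMeasure μ]
    (T : E ≃ᵐ E) (hT : MeasurePreserving T μ μ)
    (f : E → unitInterval) (hf : Measurable f) (hf_mean : ∫ x, (f x : ℝ) ∂μ = 1 / 2)
    (hf_int : ∫⁻ x, (ENNReal.ofReal (Real.sqrt ((f x : ℝ) * (1 - (f x : ℝ)))))⁻¹ ∂μ < ⊤) :
    (∀ᵐ ε ∂(OrientedLattice.annealedLaw μ T f), OrientedLattice.IsTransient ε) ∧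
      (∀ᵐ x ∂μ, ∀ᵐ ε ∂(OrientedLattice.quenchedLaw T f x), OrientedLattice.IsTransient ε) := by
  have h := OrientedLattice.ae_annealedLaw_isTransient hT hf hf_int
  exact ⟨h, OrientedLattice.ae_ae_quenchedLaw_of_ae_annealedLaw hf h⟩
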